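/- Let $\eta_0^f,\eta_0^c$ be probability measures on $\mathbb{R}$, let $M_n^f,M_n^c$ ($n\ge 1$) be Markov kernels on $\mathbb{R}$, and let $G_n:\mathbb{R}\to[0,\infty)$ ($n\ge0$) be bounded and continuous. For $s\in\{f,c\}$ put $$\gamma_n^s(\varphi)=\int \varphi(x_n)\prod_{p=0}^{n-1}G_p(x_p)\,\eta_0^s(dx_0)\prod_{p=1}^nM_p^s(x_{p-1},dx_p),\qquad \eta_n^s(\varphi)=\frac{\gamma_n^s(\varphi)}{\gamma_n^s(1)},\qquad \overline\eta_n^s(\varphi)=\frac{\eta_n^s(G_n\varphi)}{\eta_n^s(G_n)},$$ where $\eta_n^s(G_n)>0$ is assumed for all $n\ge0$ and $s\in\{f,c\}$. Let $\check\eta_0^W$ be a probability measure on $\mathbb{R}^2$ with marginals $\eta_0^f,\eta_0^c$, and let $\check M_n$ ($n\ge1$) be Markov kernels on $\mathbb{R}^2$ such that $\check M_n((x,x'),\cdot)$ has marginals $M_n^f(x,\cdot)$ and $M_n^c(x',\cdot)$. For a measure $\mu$ on $\mathbb{R}$ let $F_\mu(x)=\mu((-\infty,x])$ and $F_\mu^{-1}(w)=\inf\{x:F_\mu(x)\ge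 w\}$. Assume that, for every $n\geq 0$ and $s\in\{f,c\}$, $F_{\overline\eta_n^s}$ is continuous on $\mathbb{R}$ and $F_{\overline\eta_n^s}^{-1}$ is continuous on $(0,1)$. For $n\ge1$ let $$\check\Phi_n^W(\mu,\nu)(\varphi)=\int_0^1\check M_n(\varphi)\big(F_\mu^{-1}(w),F_\nu^{-1}(w)\big)\,dw,\qquad \check\eta_n^W=\check\Phi_n^W(\overline\eta_{n-1}^f,\overline\eta_{n-1}^c).$$ For each $N$, the Wasserstein-coupled multilevel particle filter is the Markov chain of $N$ pairs $u_n^i=(x_n^{i,f},x_n^{i,c})$, $1\le i\le N$, such that $u_0^1,\dots,u_0^N$ are independent with law $\check\eta_0^W$ and, given the particles up to time $n-1$, the pairs $u_n^1,\dots,u_n^N$ are independent with law $\check\Phi_n^W(\overline\eta_{n-1}^{N,f},\overline\eta_{n-1}^{N,c})$, where $$\overline\eta_{n-1}^{N,s}=\sum_{i=1}^N\frac{G_{n-1}(x_{n-1}^{i,s})}{\sum_{j=1}^NG_{n-1}(x_{n-1}^{j,s})}\,\delta_{x_{n-1}^{i,s}}$$ (if all the weights vanish, $F^{-1}_{\overline\eta_{n-1}^{N,s}}$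 is replaced by $0$). Let $\check\eta_n^{N,W}=\frac1N\sum_{i=1}^N\delta_{u_n^i}$. For a bounded measurable function $\varphi$ let $Q_{n,n}^s(\varphi)=\varphi$, $Q_{p,n}^s(\varphi)(x)=G_p(x)\int Q_{p+1,n}^s(\varphi)(y)\,M_{p+1}^s(x,dy)$ for $0\le p<n$, and $$D_{p,n}^s(\varphi)=\frac{Q_{p,n}^s(\varphi-\eta_n^s(\varphi))}{\eta_p^s(Q_{p,n}^s(1))},\qquad 0\le p\le n.$$ Suppose that $\check M_n,M_n^f,M_n^c$ are Feller (they map bounded continuous functions to bounded continuous functions) for every $n\ge1$. Then for every $n\ge0$ and all bounded continuous $\varphi,\psi:\mathbb{R}\to\mathbb{R}$, with $(\varphi\otimes1)(x,x')=\varphi(x)$ and $(1\otimes\psi)(x,x')=\psi(x')$, as $N\to\infty$, $$\sqrt N\,[\check\eta_n^{N,W}-\check\eta_n^W](\varphi\otimes1-1\otimes\psi)\ \Rightarrow\ \mathcal N\Big(0,\ \sum_{p=0}^n\check\eta_p^W\big([D_{p,n}^f(\varphi)\otimes1-1\otimes D_{p,n}^c(\psi)]^2\big)\Big)$$ in distribution,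 where the limit is the point mass at $0$ if the variance is $0$. -/

import Mathlib

open MeasureTheory ProbabilityTheory Filter Topology
open scoped ENNReal BoundedContinuousFunction

noncomputable section

namespace MLPF

/-! ### One Feynman-Kac flow -/

/-- A kernel is Feller if it maps bounded continuous functions to continuous functions
(boundedness of the image is automatic for a Markov kernel). -/
def IsFeller {X : Type*} [TopologicalSpace X] [MeasurableSpace X] (κ : Kernel X X) : Prop :=
  ∀ h : X →ᵇ ℝ, Continuous fun x => ∫ y, h y ∂(κ x)

/-- The unnormalised flow
`γ_n(φ) = ∫ φ(x_n) ∏_{p<n} G_p(x_p) η₀(dx_0) ∏_{1≤p≤n} M_p(x_{p-1}, dx_p)`,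
written as a measure: `γ_0 = η₀` and `γ_{n+1}(dy) = ∫ γ_n(dx) G_n(x) M_{n+1}(x, dy)`. -/
def gammaM (η₀ : Measure ℝ) (M : ℕ → Kernel ℝ ℝ) (G : ℕ → ℝ → ℝ) : ℕ → Measure ℝ
  | 0 => η₀
  | n + 1 => M (n + 1) ∘ₘ (gammaM η₀ M G n).withDensity fun x => ENNReal.ofReal (G n x)

/-- The predictor `η_n = γ_n / γ_n(1)`. -/
def predictor (η₀ : Measure ℝ) (M : ℕ → Kernel ℝ ℝ) (G : ℕ → ℝ → ℝ) (n : ℕ) : Measure ℝ :=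
  (gammaM η₀ M G n Set.univ)⁻¹ • gammaM η₀ M G n

/-- The filter `η̄_n(φ) = η_n(G_n φ) / η_n(G_n)`. -/
def filterM (η₀ : Measure ℝ) (M : ℕ → Kernel ℝ ℝ) (G : ℕ → ℝ → ℝ) (n : ℕ) : Measure ℝ :=
  (∫⁻ x, ENNReal.ofReal (G n x) ∂(predictor η₀ M G n))⁻¹ •
    (predictor η₀ M G n).withDensity fun x => ENNReal.ofReal (G n x)

/-- `semigroupQ M G k p` is the operator `Q_{p,p+k}`, where
`Q_{p,n} = Q_{p+1} ⋯ Q_n` and `Q_{p+1}(x, dy) = G_p(x) M_{p+1}(x, dy)`. -/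
def semigroupQ (M : ℕ → Kernel ℝ ℝ) (G : ℕ → ℝ → ℝ) : ℕ → ℕ → (ℝ → ℝ) → ℝ → ℝ
  | 0, _, h => h
  | k + 1, p, h => fun x => G p x * ∫ y, semigroupQ M G k (p + 1) h y ∂(M (p + 1) x)

/-- `D_{p,n}(φ) = Q_{p,n}(φ - η_n(φ)) / η_p(Q_{p,n}(1))`, for `p ≤ n`. -/
def operatorD (η₀ : Measure ℝ) (M : ℕ → Kernel ℝ ℝ) (G : ℕ → ℝ → ℝ) (p n : ℕ)
    (h : ℝ → ℝ) (x : ℝ) : ℝ :=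
  semigroupQ M G (n - p) p (fun y => h y - ∫ z, h z ∂(predictor η₀ M G n)) x /
    ∫ y, semigroupQ M G (n - p) p (fun _ => 1) y ∂(predictor η₀ M G p)

/-! ### Distribution functions and the Wasserstein coupling -/

/-- The distribution function `F_μ(x) = μ((-∞, x])`. -/
def distFun (μ : Measure ℝ) (x : ℝ) : ℝ := μ.real (Set.Iic x)

/-- The generalised inverse `F_μ⁻¹(w) = inf {x : F_μ(x) ≥ w}`. -/
def quantile (μ : Measure ℝ) (w : ℝ) : ℝ := sInf {x : ℝ | w ≤ distFun μ x}

/-- The inverse distribution function coupling `∫_0^1 δ_{(F_μ⁻¹(w), F_ν⁻¹(w))} dw`: the law of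
`(F_μ⁻¹(W), F_ν⁻¹(W))` for `W` uniform on `(0, 1)`. -/
def quantileCoupling (μ ν : Measure ℝ) : Measure (ℝ × ℝ) :=
  (volume.restrict (Set.Ioo (0 : ℝ) 1)).map fun w => (quantile μ w, quantile ν w)

/-- The limiting coupling: `η̌_0^W` is the given coupling of the initial laws, and
`η̌_{n+1}^W` is the image under the coupled kernel `M̌_{n+1}` of the inverse distribution
function coupling of the two filters `η̄_n^f`, `η̄_n^c`. -/
def limitCoupling (η₀f η₀c : Measure ℝ) (η₀W : Measure (ℝ × ℝ)) (Mf Mc : ℕ → Kernel ℝ ℝ)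
    (MW : ℕ → Kernel (ℝ × ℝ) (ℝ × ℝ)) (G : ℕ → ℝ → ℝ) : ℕ → Measure (ℝ × ℝ)
  | 0 => η₀W
  | n + 1 => MW (n + 1) ∘ₘ quantileCoupling (filterM η₀f Mf G n) (filterM η₀c Mc G n)

/-- The asymptotic variance
`∑_{p=0}^n η̌_p^W([D_{p,n}^f(φ) ⊗ 1 - 1 ⊗ D_{p,n}^c(ψ)]²)`. -/
def asympVar (η₀f η₀c : Measure ℝ) (η₀W : Measure (ℝ × ℝ)) (Mf Mc : ℕ → Kernel ℝ ℝ)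
    (MW : ℕ → Kernel (ℝ × ℝ) (ℝ × ℝ)) (G : ℕ → ℝ → ℝ) (n : ℕ) (φ ψ : ℝ → ℝ) : ℝ :=
  ∑ p ∈ Finset.range (n + 1),
    ∫ u, (operatorD η₀f Mf G p n φ u.1 - operatorD η₀c Mc G p n ψ u.2) ^ 2
      ∂(limitCoupling η₀f η₀c η₀W Mf Mc MW G p)

theorem asympVar_nonneg (η₀f η₀c : Measure ℝ) (η₀W : Measure (ℝ × ℝ)) (Mf Mc : ℕ → Kernel ℝ ℝ)
    (MW : ℕ → Kernel (ℝ × ℝ) (ℝ × ℝ)) (G : ℕ → ℝ → ℝ) (n : ℕ) (φ ψ : ℝ → ℝ) :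
    0 ≤ asympVar η₀f η₀c η₀W Mf Mc MW G n φ ψ :=
  Finset.sum_nonneg fun _ _ => integral_nonneg fun _ => sq_nonneg _

/-! ### The particle system -/

/-- The empirical measure `(1/N) ∑_i δ_{x_i}`. -/
def empirical {X : Type*} [MeasurableSpace X] {N : ℕ} (x : Fin N → X) : Measure X :=
  (N : ℝ≥0∞)⁻¹ • ∑ i, Measure.dirac (x i)

/-- The weighted empirical measure `∑_i g(x_i) / (∑_j g(x_j)) δ_{x_i}`.
(If all weights vanish this is the zero measure, whose generalised inverse is `0`, so that
resampling then puts the particle at the origin.) -/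
def weightedEmpirical (g : ℝ → ℝ) {N : ℕ} (x : Fin N → ℝ) : Measure ℝ :=
  ∑ i, ENNReal.ofReal (g (x i) / ∑ j, g (x j)) • Measure.dirac (x i)

instance (g : ℝ → ℝ) {N : ℕ} (x : Fin N → ℝ) : IsFiniteMeasure (weightedEmpirical g x) := by
  constructor
  simp only [weightedEmpirical, Measure.coe_finsetSum, Finset.sum_apply, Measure.smul_apply,
    measure_univ, smul_eq_mul, mul_one]
  exact ENNReal.sum_lt_top.2 fun _ _ => ENNReal.ofReal_lt_top

theorem measurable_weightedEmpirical {g : ℝ → ℝ} (hg : Measurable g) (N : ℕ) :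
    Measurable fun x : Fin N → ℝ => weightedEmpirical g x := by
  refine Measure.measurable_of_measurable_coe _ fun s hs => ?_
  simp only [weightedEmpirical, Measure.coe_finsetSum, Finset.sum_apply, Measure.smul_apply,
    smul_eq_mul]
  refine Finset.measurable_sum _ fun i _ => Measurable.mul (by fun_prop) ?_
  exact (Measure.measurable_coe hs).comp (Measure.measurable_dirac.comp (measurable_pi_apply i))

theorem distFun_mono (μ : Measure ℝ) [IsFiniteMeasure μ] : Monotone (distFun μ) :=
  fun _ _ h => measureReal_mono (Set.Iic_subset_Iic.2 h)

theorem quantile_le_iff (μ : Measure ℝ) [IsFiniteMeasure μ] {w t : ℝ} (hw : 0 < w)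
    (hne : ∃ k : ℕ, w ≤ distFun μ k) : quantile μ w ≤ t ↔ w ≤ distFun μ t := by
  have hbdd : BddBelow {x : ℝ | w ≤ distFun μ x} := by
    have hI : ⋂ k : ℕ, Set.Iic (-(k : ℝ)) = ∅ := by
      ext x
      simp only [Set.mem_iInter, Set.mem_Iic, Set.mem_empty_iff_false, iff_false, not_forall,
        not_le]
      obtain ⟨k, hk⟩ := exists_nat_gt (-x)
      exact ⟨k, by linarith⟩
    have h0 := tendsto_measure_iInter_atTop (μ := μ) (s := fun k : ℕ => Set.Iic (-(k : ℝ)))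
      (fun k => measurableSet_Iic.nullMeasurableSet)
      (fun a b hab => Set.Iic_subset_Iic.2 (by simpa using hab)) ⟨0, measure_ne_top _ _⟩
    rw [hI, measure_empty] at h0
    have h1 := (ENNReal.tendsto_toReal ENNReal.zero_ne_top).comp h0
    obtain ⟨k, hb⟩ := (h1.eventually (gt_mem_nhds (by simpa using hw))).exists
    replace hb : distFun μ (-(k : ℝ)) < w := hb
    generalize -(k : ℝ) = b at hb
    refine ⟨b, fun x hx => ?_⟩
    by_contra hlt
    exact absurd (hx.trans (distFun_mono μ (not_le.1 hlt).le)) (not_le.2 hb)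
  have hne' : {x : ℝ | w ≤ distFun μ x}.Nonempty := let ⟨k, hk⟩ := hne; ⟨k, hk⟩
  refine ⟨fun h => ?_, fun h => csInf_le hbdd h⟩
  have hs : ∀ s, t < s → w ≤ distFun μ s := fun s hts => by
    obtain ⟨y, hy, hys⟩ := exists_lt_of_csInf_lt hne' (h.trans_lt hts)
    exact le_trans hy (distFun_mono μ hys.le)
  have hI : Set.Iic t = ⋂ k : ℕ, Set.Iic (t + 1 / ((k : ℝ) + 1)) := by
    ext x
    simp only [Set.mem_Iic, Set.mem_iInter]
    refine ⟨fun hx k => hx.trans (by simp; positivity), fun hx => ?_⟩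
    have hl : Tendsto (fun k : ℕ => t + 1 / ((k : ℝ) + 1)) atTop (𝓝 (t + 0)) :=
      tendsto_const_nhds.add tendsto_one_div_add_atTop_nhds_zero_nat
    rw [add_zero] at hl
    exact ge_of_tendsto' hl hx
  have hlim : Tendsto (fun k : ℕ => distFun μ (t + 1 / ((k : ℝ) + 1))) atTop
      (𝓝 (distFun μ t)) := by
    have := tendsto_measure_iInter_atTop (μ := μ)
      (s := fun k : ℕ => Set.Iic (t + 1 / ((k : ℝ) + 1)))
      (fun k => measurableSet_Iic.nullMeasurableSet)
      (fun a b hab => Set.Iic_subset_Iic.2 (by gcongr)) ⟨0, measure_ne_top _ _⟩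
    rw [← hI] at this
    exact (ENNReal.tendsto_toReal (measure_ne_top _ _)).comp this
  exact ge_of_tendsto' hlim fun k => hs _ (by simp; positivity)

theorem measurable_quantile {α : Type*} [MeasurableSpace α] {κ : α → Measure ℝ}
    (hκ : Measurable κ) [∀ a, IsFiniteMeasure (κ a)] :
    Measurable fun z : α × ℝ => quantile (κ z.1) z.2 := by
  have hF : ∀ t, Measurable fun z : α × ℝ => distFun (κ z.1) t := fun t =>
    ((Measure.measurable_coe measurableSet_Iic).comp (hκ.comp measurable_fst)).ennreal_toReal
  have hset : ∀ t, MeasurableSet {z : α × ℝ | z.2 ≤ distFun (κ z.1) t} := fun t =>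
    measurableSet_le measurable_snd (hF t)
  set A : Set (α × ℝ) := {z | 0 < z.2} ∩ ⋃ k : ℕ, {z | z.2 ≤ distFun (κ z.1) k} with hA
  have hAm : MeasurableSet A :=
    (measurableSet_lt measurable_const measurable_snd).inter
      (MeasurableSet.iUnion fun k => hset k)
  have hAc : ∀ z ∉ A, quantile (κ z.1) z.2 = 0 := by
    intro z hz
    by_cases hw : 0 < z.2
    · have : {x : ℝ | z.2 ≤ distFun (κ z.1) x} = ∅ := by
        ext x
        simp only [Set.mem_ofPred_eq, Set.mem_empty_iff_false, iff_false]
        intro hx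
        obtain ⟨k, hk⟩ := exists_nat_ge x
        exact hz ⟨hw, Set.mem_iUnion.2 ⟨k, hx.trans (distFun_mono _ hk)⟩⟩
      rw [quantile, this, Real.sInf_empty]
    · have : {x : ℝ | z.2 ≤ distFun (κ z.1) x} = Set.univ :=
        Set.eq_univ_of_forall fun x => (not_lt.1 hw).trans measureReal_nonneg
      rw [quantile, this, Real.sInf_univ]
  refine measurable_of_Iic fun t => ?_
  have : (fun z : α × ℝ => quantile (κ z.1) z.2) ⁻¹' Set.Iic t =
      (A ∩ {z | z.2 ≤ distFun (κ z.1) t}) ∪ (Aᶜ ∩ {_z | (0 : ℝ) ≤ t}) := by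
    ext z
    by_cases hz : z ∈ A
    · simp [hz, quantile_le_iff (κ z.1) hz.1 (by simpa using hz.2)]
    · simp [hz, hAc z hz]
  rw [this]
  exact (hAm.inter (hset t)).union (hAm.compl.inter (MeasurableSet.const _))

/-- Coupled resampling: given the particles `u^i = (x^{i,f}, x^{i,c})`, `i = 1, …, N`, the inverse
distribution function coupling of the two weighted empirical measures with weights `g`. -/
def resample (g : ℝ → ℝ) (hg : Measurable g) (N : ℕ) : Kernel (Fin N → ℝ × ℝ) (ℝ × ℝ) where
  toFun u := quantileCoupling (weightedEmpirical g fun i => (u i).1)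
    (weightedEmpirical g fun i => (u i).2)
  measurable' := by
    have h1 := measurable_quantile (α := Fin N → ℝ × ℝ)
      (κ := fun u => weightedEmpirical g fun i => (u i).1) ((measurable_weightedEmpirical hg N).comp
        (f := fun u : Fin N → ℝ × ℝ => fun i => (u i).1) (by fun_prop))
    have h2 := measurable_quantile (α := Fin N → ℝ × ℝ)
      (κ := fun u => weightedEmpirical g fun i => (u i).2) ((measurable_weightedEmpirical hg N).comp
        (f := fun u : Fin N → ℝ × ℝ => fun i => (u i).2) (by fun_prop))
    have h := h1.prodMk h2
    refine Measure.measurable_of_measurable_coe _ fun s hs => ?_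
    have hm := measurable_measure_prodMk_left (ν := volume.restrict (Set.Ioo (0 : ℝ) 1)) (h hs)
    convert hm using 2 with u
    exact Measure.map_apply (h.comp measurable_prodMk_left) hs

instance (g : ℝ → ℝ) (hg : Measurable g) (N : ℕ) : IsMarkovKernel (resample g hg N) := by
  constructor
  intro u
  have h (c : ℝ × ℝ → ℝ) := (measurable_quantile (α := Unit)
    (κ := fun _ => weightedEmpirical g fun i => c (u i)) measurable_const).comp
      (measurable_prodMk_left (x := ()))
  have : IsProbabilityMeasure (volume.restrict (Set.Ioo (0 : ℝ) 1)) := ⟨by simp⟩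
  exact Measure.isProbabilityMeasure_map ((h Prod.fst).prodMk (h Prod.snd)).aemeasurable

/-- `N` conditionally independent draws from a Markov kernel. -/
def iidKernel {α β : Type*} [MeasurableSpace α] [MeasurableSpace β] (κ : Kernel α β)
    [IsMarkovKernel κ] (N : ℕ) : Kernel α (Fin N → β) where
  toFun a := Measure.pi fun _ => κ a
  measurable' := by
    refine Measurable.measure_of_isPiSystem_of_isProbabilityMeasure
      generateFrom_pi.symm isPiSystem_pi ?_
    rintro _ ⟨s, hs, rfl⟩
    simp only [Measure.pi_pi]
    exact Finset.measurable_prod _ fun i _ =>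
      κ.measurable_coe (hs i (Set.mem_univ i))

instance {α β : Type*} [MeasurableSpace α] [MeasurableSpace β] (κ : Kernel α β)
    [IsMarkovKernel κ] (N : ℕ) : IsMarkovKernel (iidKernel κ N) :=
  ⟨fun a => inferInstanceAs (IsProbabilityMeasure (Measure.pi fun _ => κ a))⟩

/-- The transition from time `p` to time `p + 1` of the system of `N` pairs: given the particles at
time `p`, the new particles are independent, each with law
`Φ̌_{p+1}^W(η̄_p^{N,f}, η̄_p^{N,c})`, that is, coupled resampling followed by `M̌_{p+1}`. -/
def step (MW : ℕ → Kernel (ℝ × ℝ) (ℝ × ℝ)) [∀ n, IsMarkovKernel (MW n)] (G : ℕ → ℝ →ᵇ ℝ)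
    (N p : ℕ) : Kernel (Fin N → ℝ × ℝ) (Fin N → ℝ × ℝ) :=
  iidKernel (MW (p + 1) ∘ₖ resample (G p) (G p).continuous.measurable N) N

instance (MW : ℕ → Kernel (ℝ × ℝ) (ℝ × ℝ)) [∀ n, IsMarkovKernel (MW n)] (G : ℕ → ℝ →ᵇ ℝ)
    (N p : ℕ) : IsMarkovKernel (step MW G N p) := by
  unfold step; infer_instance

/-- The joint law of the multilevel particle filter with `N` pairs of particles,
`(u_0^{1:N}, u_1^{1:N}, …)`: the initial pairs are independent with law `η̌_0`, and the system
evolves as a Markov chain with the transitions `step`. -/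
def particleLaw (η₀W : Measure (ℝ × ℝ)) (MW : ℕ → Kernel (ℝ × ℝ) (ℝ × ℝ))
    [∀ n, IsMarkovKernel (MW n)] (G : ℕ → ℝ →ᵇ ℝ) (N : ℕ) :
    Measure (ℕ → Fin N → ℝ × ℝ) :=
  Kernel.trajMeasure (X := fun _ => Fin N → ℝ × ℝ) (Measure.pi fun _ => η₀W) fun p =>
    (step MW G N p).comap (fun h : (i : Finset.Iic p) → Fin N → ℝ × ℝ =>
      h ⟨p, Finset.mem_Iic.2 le_rfl⟩) (measurable_pi_apply _)

end MLPF

end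

noncomputable section

namespace MLPF

/-! ### Generic estimates -/

/-! The proof is an induction on time for the characteristic function of the normalised error. Write
F = φ⊗1 - 1⊗ψ. Given the pairs u at time n, the pairs at time n + 1 are independent with a common
law l_u (`mutationLaw`), so the error splits into √N (average of F - l_u(F)), a normalised sum of
conditionally i.i.d. bounded centred variables, and the bias √N (l_u(F) - η̌_{n+1}(F)), which is a
function of u.

The bias involves only the two marginals. On each coordinate the quantile coupling reduces to
ordinary multinomial resampling (`map_quantile`), so the bias is a difference of ratios of empirical
averages. Replacing each random denominator by its limit gives the empirical average of the function
φ' (`pullback`) centred under η_n, up to a quadratic remainder. Mean-square rates of order 1/N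
(`exists_meanSquare_bound`) make that remainder O(1/N) in L¹, hence negligible after multiplication
by √N. To first order the bias is therefore the time-n error of the pair (φ', ψ').

The conditional fluctuation does see the coupling. A quantitative i.i.d. central limit theorem
(`norm_charFun_pow_sub_exp_le`) makes its conditional characteristic function close to that of a
Gaussian with variance Var_{l_u}(F). This variance converges to the variance of F under η̌_{n+1}
once l_u converges weakly in probability. The weighted empirical measures converge weakly to the
filters, continuity of the limiting quantile functions makes the empirical quantiles converge at
each level, and dominated convergence over the level together with the Feller property transfers
this to l_u (`tendsto_integral_abs_quantileCoupling`, `tendsto_integral_abs_mutationLaw`).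

Thus the characteristic function at time n + 1 for (φ, ψ) is asymptotically exp(-t² Var(F)/2) times
the one at time n for (φ', ψ'). The variance formula obeys the same recursion because D_{p,n+1}(φ) =
D_{p,n}(φ') (`operatorD_succ`). Lévy's continuity theorem concludes. -/

theorem norm_pow_sub_pow_le {a b : ℂ} (ha : ‖a‖ ≤ 1) (hb : ‖b‖ ≤ 1) (N : ℕ) :
    ‖a ^ N - b ^ N‖ ≤ N * ‖a - b‖ := by
  induction N with
  | zero => simp
  | succ k ih =>
    have h : a ^ (k + 1) - b ^ (k + 1) = a ^ k * (a - b) + (a ^ k - b ^ k) * b := by ring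
    have h1 : ‖a ^ k * (a - b)‖ ≤ 1 * ‖a - b‖ := by
      rw [norm_mul, norm_pow]
      gcongr
      exact pow_le_one₀ (norm_nonneg _) ha
    have h2 : ‖(a ^ k - b ^ k) * b‖ ≤ (k * ‖a - b‖) * 1 := by
      rw [norm_mul]; gcongr
    rw [h]
    push_cast
    linarith [norm_add_le (a ^ k * (a - b)) ((a ^ k - b ^ k) * b)]

theorem norm_exp_ofReal_mul_I_sub_quadratic_le {x : ℝ} (hx : |x| ≤ 1) :
    ‖Complex.exp (x * Complex.I) - (1 + x * Complex.I - x ^ 2 / 2)‖ ≤ |x| ^ 3 := by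
  have h := Complex.exp_bound (x := x * Complex.I) (by simpa using hx) (n := 3) (by norm_num)
  have e : ∑ m ∈ Finset.range 3, (x * Complex.I : ℂ) ^ m / m.factorial =
      1 + x * Complex.I - x ^ 2 / 2 := by
    simp [Finset.sum_range_succ, Nat.factorial, mul_pow]
    ring
  rw [e] at h
  refine h.trans ?_
  have : ‖(x * Complex.I : ℂ)‖ = |x| := by simp
  rw [this]
  have h0 : 0 ≤ |x| ^ 3 := by positivity
  norm_num [Nat.factorial]
  linarith

theorem norm_integral_exp_le_one {X : Type*} [MeasurableSpace X] (l : Measure X)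
    [IsProbabilityMeasure l] (f : X → ℝ) : ‖∫ x, Complex.exp (f x * Complex.I) ∂l‖ ≤ 1 := by
  refine (norm_integral_le_of_norm_le_const (C := 1) (ae_of_all _ fun x => ?_)).trans (by simp)
  rw [Complex.norm_exp_ofReal_mul_I]

theorem integrable_of_abs_le {X : Type*} [MeasurableSpace X] {l : Measure X}
    [IsFiniteMeasure l] {f : X → ℝ} (hf : Measurable f) {K : ℝ} (hK : ∀ x, |f x| ≤ K) :
    Integrable f l :=
  Integrable.of_bound hf.aestronglyMeasurable K (ae_of_all _ hK)

theorem integrable_exp_mul_I {X : Type*} [MeasurableSpace X] {l : Measure X}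
    [IsFiniteMeasure l] {f : X → ℝ} (hf : Measurable f) :
    Integrable (fun x => Complex.exp (f x * Complex.I)) l :=
  Integrable.of_bound (by fun_prop) 1
    (ae_of_all _ fun x => (Complex.norm_exp_ofReal_mul_I _).le)

theorem abs_integral_le_of_abs_le {X : Type*} [MeasurableSpace X] {l : Measure X}
    [IsProbabilityMeasure l] {f : X → ℝ} {K : ℝ} (hK : ∀ x, |f x| ≤ K) : |∫ x, f x ∂l| ≤ K := by
  have := norm_integral_le_of_norm_le_const (μ := l) (f := f) (C := K) (ae_of_all _ hK)
  simpa using this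

/-- Berry-Esseen type bound for the characteristic function of a normalised sum of bounded
centred variables. -/
theorem norm_charFun_pow_sub_exp_le {X : Type*} [MeasurableSpace X] {l : Measure X}
    [IsProbabilityMeasure l] {f : X → ℝ} (hf : Measurable f) {K : ℝ} (hK : ∀ x, |f x| ≤ K)
    (h0 : ∫ x, f x ∂l = 0) {N : ℕ} (hN : 0 < N) {t : ℝ} (ht : |t| * K ≤ √N) :
    ‖(∫ x, Complex.exp ((t / √N * f x : ℝ) * Complex.I) ∂l) ^ N -
        Complex.exp (-(t ^ 2 * ∫ x, f x ^ 2 ∂l) / 2 : ℝ)‖ ≤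
      ((|t| * K) ^ 3 + (|t| * K) ^ 4) / √N := by
  obtain ⟨x₀⟩ : Nonempty X := nonempty_of_isProbabilityMeasure l
  have hK0 : 0 ≤ K := (abs_nonneg _).trans (hK x₀)
  set s := √(N : ℝ) with hs
  have hs1 : 1 ≤ s := by
    rw [hs, Real.one_le_sqrt]; exact_mod_cast hN
  have hsN : s ^ 2 = N := Real.sq_sqrt (by positivity)
  set A := |t| * K with hA
  have hA0 : 0 ≤ A := by positivity
  set v := ∫ x, f x ^ 2 ∂l with hv
  have hf2 : ∀ x, |f x ^ 2| ≤ K ^ 2 := fun x => by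
    rw [abs_pow]; gcongr; exact hK x
  have hv0 : 0 ≤ v := integral_nonneg fun x => sq_nonneg _
  have hvK : v ≤ K ^ 2 := (le_abs_self _).trans (abs_integral_le_of_abs_le hf2)
  -- exp(y) is the N-th root of the Gaussian characteristic function, so both sides become N-th
  -- powers of numbers in the unit disc, and the error is at most N times the error of one factor.
  set y : ℝ := -(t ^ 2 * v) / (2 * N) with hy
  have hNpos : (0 : ℝ) < N := by exact_mod_cast hN
  have hy0 : y ≤ 0 := by
    rw [hy]; apply div_nonpos_of_nonpos_of_nonneg <;> [(have : 0 ≤ t ^ 2 * v := by positivity); skip]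
    · linarith
    · positivity
  have htv : t ^ 2 * v ≤ A ^ 2 := by
    rw [hA, mul_pow, sq_abs]; gcongr
  have hyA : |y| ≤ A ^ 2 / (2 * s ^ 2) := by
    rw [abs_of_nonpos hy0, hy, hsN, neg_div, neg_neg]; gcongr
  have hA2 : A ^ 2 ≤ s ^ 2 := by gcongr
  have hy1 : |y| ≤ 1 := by
    refine hyA.trans ?_
    rw [div_le_one (by positivity)]; nlinarith
  have e1 : Complex.exp (-(t ^ 2 * v) / 2 : ℝ) = Complex.exp (y : ℝ) ^ N := by
    rw [← Complex.exp_nat_mul]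
    congr 1
    rw [hy]; push_cast
    have : (N : ℂ) ≠ 0 := by exact_mod_cast hN.ne'
    field_simp
  rw [e1]
  have hb : ‖Complex.exp (y : ℝ)‖ ≤ 1 := by
    rw [Complex.norm_exp]; simpa using hy0
  refine (norm_pow_sub_pow_le (norm_integral_exp_le_one l fun x => t / s * f x) hb N).trans ?_
  have hz : ∀ x, |t / s * f x| ≤ A / s := fun x => by
    rw [abs_mul, abs_div, abs_of_pos (by linarith : 0 < s), hA, div_mul_eq_mul_div]
    gcongr
    exact hK x
  have hAs : A / s ≤ 1 := by rw [div_le_one (by linarith)]; exact ht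
  -- Second-order Taylor expansion under the integral: the linear term vanishes because `f` is
  -- centred, and the quadratic term is exactly `y`.
  have b1 : ‖(∫ x, Complex.exp ((t / s * f x : ℝ) * Complex.I) ∂l) - (1 + (y : ℝ))‖ ≤
      (A / s) ^ 3 := by
    have r1 : Integrable (fun x => t / s * f x) l := integrable_of_abs_le (by fun_prop) hz
    have r2 : Integrable (fun x => (t / s * f x) ^ 2) l :=
      integrable_of_abs_le (by fun_prop) (K := (A / s) ^ 2) fun x => by
        rw [abs_pow]; gcongr; exact hz x
    have i1 : Integrable (fun x => ((t / s * f x : ℝ) : ℂ) * Complex.I) l :=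
      r1.ofReal.mul_const _
    have i2 : Integrable (fun x => (((t / s * f x) ^ 2 : ℝ) : ℂ) / 2) l :=
      r2.ofReal.div_const _
    have i3 : Integrable (fun x => 1 + ((t / s * f x : ℝ) : ℂ) * Complex.I) l :=
      (integrable_const _).add i1
    have e3 : ∫ x, (t / s * f x) ^ 2 ∂l = -2 * y := by
      simp_rw [mul_pow]
      rw [integral_const_mul, ← hv, hy, div_pow, hsN]
      field_simp
    have e2 : (1 + (y : ℝ) : ℂ) = ∫ x, (1 + ((t / s * f x : ℝ) : ℂ) * Complex.I -
        (((t / s * f x) ^ 2 : ℝ) : ℂ) / 2) ∂l := by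
      rw [integral_sub i3 i2, integral_add (integrable_const _) i1, integral_mul_const,
        integral_div, integral_complex_ofReal, integral_complex_ofReal, e3, integral_const_mul, h0]
      simp
      ring
    have i4 : Integrable (fun x => 1 + ((t / s * f x : ℝ) : ℂ) * Complex.I -
        (((t / s * f x) ^ 2 : ℝ) : ℂ) / 2) l := i3.sub i2
    rw [e2, ← integral_sub (integrable_exp_mul_I (f := fun x => t / s * f x) (by fun_prop)) i4]
    refine (norm_integral_le_of_norm_le_const (C := (A / s) ^ 3) (ae_of_all _ fun x => ?_)).trans
      (by simp)
    have := norm_exp_ofReal_mul_I_sub_quadratic_le ((hz x).trans hAs)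
    push_cast at this ⊢
    refine this.trans ?_
    gcongr
    exact hz x
  have b2 : ‖Complex.exp (y : ℝ) - (1 + (y : ℝ))‖ ≤ (A ^ 2 / (2 * s ^ 2)) ^ 2 := by
    have := Complex.norm_exp_sub_one_sub_id_le (x := (y : ℂ)) (by simpa using hy1)
    rw [← sub_sub]
    refine this.trans ?_
    rw [Complex.norm_real, Real.norm_eq_abs]
    gcongr
  have b3 : ‖(∫ x, Complex.exp ((t / s * f x : ℝ) * Complex.I) ∂l) - Complex.exp (y : ℝ)‖ ≤
      (A / s) ^ 3 + (A ^ 2 / (2 * s ^ 2)) ^ 2 := by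
    refine (norm_sub_le_norm_sub_add_norm_sub _ (1 + (y : ℂ)) _).trans ?_
    rw [norm_sub_rev (1 + (y : ℂ))]
    exact add_le_add b1 b2
  -- With N = s² the one-factor errors of orders s⁻³ and s⁻⁴ leave 1/s and 1/s²; the latter is
  -- absorbed using s ≥ 1.
  calc _ ≤ (N : ℝ) * ((A / s) ^ 3 + (A ^ 2 / (2 * s ^ 2)) ^ 2) := by gcongr
    _ = (A ^ 3 + A ^ 4 / (4 * s)) / s := by
      rw [← hsN]; field_simp; ring
    _ ≤ _ := by
      gcongr
      rw [div_le_iff₀ (by positivity)]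
      have : 0 ≤ A ^ 4 := by positivity
      nlinarith

/-! ### Averages over finitely many points -/

/-- The average of `f` over a finite family of points. -/
def avg {X : Type*} {N : ℕ} (u : Fin N → X) (f : X → ℝ) : ℝ := (N : ℝ)⁻¹ * ∑ i, f (u i)

theorem integral_empirical {X : Type*} [MeasurableSpace X] {N : ℕ} (u : Fin N → X) {f : X → ℝ}
    (hf : Measurable f) : ∫ x, f x ∂(empirical u) = avg u f := by
  rw [empirical, integral_smul_measure, integral_finsetSum_measure]
  · simp [avg, integral_dirac' _ _ hf.stronglyMeasurable]
  · exact fun i _ => integrable_dirac' hf.stronglyMeasurable (by simp)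

theorem measurable_avg {X : Type*} [MeasurableSpace X] {N : ℕ} {f : X → ℝ}
    (hf : Measurable f) : Measurable fun u : Fin N → X => avg u f := by
  unfold avg; fun_prop

theorem avg_sub {X : Type*} {N : ℕ} (u : Fin N → X) (f g : X → ℝ) :
    avg u (fun x => f x - g x) = avg u f - avg u g := by
  simp [avg, mul_sub, Finset.sum_sub_distrib]

theorem avg_mul_const {X : Type*} {N : ℕ} (u : Fin N → X) (f : X → ℝ) (c : ℝ) :
    avg u (fun x => f x * c) = avg u f * c := by
  simp [avg, ← Finset.sum_mul, mul_assoc]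

theorem avg_const {X : Type*} {N : ℕ} (hN : 0 < N) (u : Fin N → X) (c : ℝ) :
    avg u (fun _ => c) = c := by
  have : (N : ℝ) ≠ 0 := by exact_mod_cast hN.ne'
  simp [avg, this]

theorem abs_avg_le {X : Type*} {N : ℕ} (u : Fin N → X) {f : X → ℝ} {K : ℝ} (hK0 : 0 ≤ K)
    (hK : ∀ x, |f x| ≤ K) : |avg u f| ≤ K := by
  rcases Nat.eq_zero_or_pos N with rfl | hN
  · simpa [avg] using hK0
  have hN' : (0 : ℝ) < N := by exact_mod_cast hN
  rw [avg, abs_mul, abs_of_pos (inv_pos.2 hN'), inv_mul_le_iff₀ hN']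
  calc |∑ i, f (u i)| ≤ ∑ i : Fin N, |f (u i)| := Finset.abs_sum_le_sum_abs _ _
    _ ≤ ∑ i : Fin N, K := Finset.sum_le_sum fun i _ => hK _
    _ = N * K := by simp

/-- Independence factorises the exponential, and √N / N = 1 / √N. For N = 0 both sides are 1. -/
theorem integral_exp_avg_pi {X : Type*} [MeasurableSpace X] (l : Measure X)
    [IsProbabilityMeasure l] (f : X → ℝ) {N : ℕ} (t : ℝ) :
    ∫ v, Complex.exp ((t * √N * avg v f : ℝ) * Complex.I) ∂(Measure.pi fun _ : Fin N => l) =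
      (∫ x, Complex.exp ((t / √N * f x : ℝ) * Complex.I) ∂l) ^ N := by
  have h := integral_fintype_prod_eq_prod (μ := fun _ : Fin N => l)
    (fun _ x => Complex.exp ((t / √N * f x : ℝ) * Complex.I))
  simp only [Finset.prod_const, Finset.card_univ, Fintype.card_fin] at h
  rw [← h]
  congr 1 with v
  rw [← Complex.exp_sum]
  congr 1
  rw [← Finset.sum_mul, avg]
  push_cast
  congr 1
  rw [← Finset.mul_sum, ← mul_assoc]
  congr 1
  rcases Nat.eq_zero_or_pos N with rfl | hN
  · simp
  have : (√N : ℂ) ^ 2 = N := by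
    rw [← Complex.ofReal_pow, Real.sq_sqrt (by positivity)]; simp
  have h1 : (√N : ℂ) ≠ 0 := by
    simpa using hN.ne'
  rw [← this]
  field_simp

/-- The left side is the variance of an average of N independent copies, hence Var(f)/N, and Var(f)
≤ K². -/
theorem integral_sq_avg_pi_le {X : Type*} [MeasurableSpace X] (l : Measure X)
    [IsProbabilityMeasure l] {f : X → ℝ} (hf : Measurable f) {K : ℝ} (hK : ∀ x, |f x| ≤ K)
    {N : ℕ} (hN : 0 < N) :
    ∫ v, (avg v f - ∫ x, f x ∂l) ^ 2 ∂(Measure.pi fun _ : Fin N => l) ≤ K ^ 2 / N := by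
  have hm : MemLp f 2 l := MemLp.of_bound hf.aestronglyMeasurable K (ae_of_all _ hK)
  have h := variance_sum_pi (μ := fun _ : Fin N => l) (X := fun _ => f) fun _ => hm
  have hN' : (0 : ℝ) < N := by exact_mod_cast hN
  have e : (∑ i : Fin N, fun ω : Fin N → X => f (ω i)) = fun ω => ∑ i, f (ω i) := by
    ext; simp
  have hmean : ∫ v, avg v f ∂(Measure.pi fun _ : Fin N => l) = ∫ x, f x ∂l := by
    unfold avg
    rw [integral_const_mul, integral_finsetSum _ fun i _ =>
      integrable_of_abs_le (by fun_prop) fun v => hK (v i)]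
    simp_rw [integral_comp_eval (μ := fun _ : Fin N => l) hf.aestronglyMeasurable]
    simp
    field_simp
  have h2 : ∫ v, (avg v f - ∫ x, f x ∂l) ^ 2 ∂(Measure.pi fun _ : Fin N => l) =
      Var[fun v => avg v f; Measure.pi fun _ : Fin N => l] := by
    rw [variance_eq_integral (measurable_avg hf).aemeasurable, hmean]
  rw [h2]
  unfold avg
  rw [variance_const_mul, ← e, h]
  have h3 : Var[f; l] ≤ K ^ 2 := by
    refine (variance_le_expectation_sq hf.aestronglyMeasurable).trans ?_
    refine (le_abs_self _).trans (abs_integral_le_of_abs_le fun x => ?_)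
    simp only [Pi.pow_apply, abs_pow]; gcongr; exact hK x
  simp only [Finset.sum_const, Finset.card_univ, Fintype.card_fin, nsmul_eq_mul]
  rw [inv_pow, inv_mul_eq_div, div_le_div_iff₀ (by positivity) hN']
  nlinarith [mul_le_mul_of_nonneg_left h3 (sq_nonneg (N : ℝ))]

/-- Replacing a random denominator y by its limit y₀ costs only a quadratic error. If y ≥ y₀/2, the
difference is x(y₀ - y)/(y y₀), a product of two small quantities. Otherwise |y - y₀| > y₀/2, and
the crude bound K(1 + 1/y₀) is itself at most a multiple of (y - y₀)². Nothing but boundedness is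
asked of `b` when y ≤ 0, which accommodates vanishing weights. -/
theorem abs_ratio_sub_le {b x y y₀ K : ℝ} (hy₀ : 0 < y₀) (hb : |b| ≤ K) (hx : |x| ≤ K)
    (h : 0 < y → b = x / y) :
    |b - x / y₀| ≤ (2 / y₀ ^ 2 + 4 * K * (1 + 1 / y₀) / y₀ ^ 2) * (x ^ 2 + (y - y₀) ^ 2) := by
  have hK : 0 ≤ K := (abs_nonneg _).trans hb
  rw [add_mul]
  rcases le_or_gt (y₀ / 2) y with hy | hy
  · have hy' : 0 < y := by linarith
    have h1 : 0 ≤ 4 * K * (1 + 1 / y₀) / y₀ ^ 2 * (x ^ 2 + (y - y₀) ^ 2) := by positivity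
    rw [h hy']
    have e : x / y - x / y₀ = x * (y₀ - y) / (y * y₀) := by field_simp
    rw [e, abs_div, abs_mul, abs_of_pos (mul_pos hy' hy₀)]
    have h2 : |x| * |y₀ - y| / (y * y₀) ≤ 2 / y₀ ^ 2 * (x ^ 2 + (y - y₀) ^ 2) := by
      have : |x| * |y₀ - y| ≤ x ^ 2 + (y - y₀) ^ 2 := by
        rw [← sq_abs x, ← sq_abs (y - y₀), abs_sub_comm y]
        nlinarith [sq_nonneg (|x| - |y₀ - y|), sq_nonneg (|x|), sq_nonneg (|y₀ - y|)]
      calc |x| * |y₀ - y| / (y * y₀) ≤ (x ^ 2 + (y - y₀) ^ 2) / (y₀ / 2 * y₀) := by gcongr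
        _ = _ := by field_simp
    linarith
  · have h1 : 0 ≤ 2 / y₀ ^ 2 * (x ^ 2 + (y - y₀) ^ 2) := by positivity
    have h2 : |b - x / y₀| ≤ K * (1 + 1 / y₀) := by
      refine (abs_sub _ _).trans ?_
      rw [abs_div, abs_of_pos hy₀, mul_add, mul_one, mul_one_div]
      gcongr
    have h3 : y₀ ^ 2 / 4 ≤ (y - y₀) ^ 2 := by nlinarith
    have h4 : K * (1 + 1 / y₀) ≤ 4 * K * (1 + 1 / y₀) / y₀ ^ 2 * (x ^ 2 + (y - y₀) ^ 2) := by
      have e : K * (1 + 1 / y₀) = 4 * K * (1 + 1 / y₀) / y₀ ^ 2 * (y₀ ^ 2 / 4) := by field_simp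
      calc K * (1 + 1 / y₀) = 4 * K * (1 + 1 / y₀) / y₀ ^ 2 * (y₀ ^ 2 / 4) := e
        _ ≤ _ := by gcongr; nlinarith [sq_nonneg x]
    linarith

/-! ### Integrals against composed kernels -/

theorem integral_comp_measure {α β E : Type*} [MeasurableSpace α] [MeasurableSpace β]
    [NormedAddCommGroup E] [NormedSpace ℝ E] {κ : Kernel α β} {μ : Measure α} {f : β → E}
    (hf : Integrable f (κ ∘ₘ μ)) : ∫ y, f y ∂(κ ∘ₘ μ) = ∫ x, ∫ y, f y ∂(κ x) ∂μ := by
  rw [Measure.comp_eq_comp_const_apply] at hf ⊢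
  rw [Kernel.integral_comp hf, Kernel.const_apply]

theorem integrable_integral_comp_measure {α β E : Type*} [MeasurableSpace α] [MeasurableSpace β]
    [NormedAddCommGroup E] [NormedSpace ℝ E] {κ : Kernel α β} {μ : Measure α} {f : β → E}
    (hf : Integrable f (κ ∘ₘ μ)) : Integrable (fun x => ∫ y, f y ∂(κ x)) μ := by
  rw [Measure.comp_eq_comp_const_apply] at hf
  simpa using Integrable.integral_comp hf

/-! ### Quantiles -/

theorem exists_nat_le_distFun (μ : Measure ℝ) [IsProbabilityMeasure μ] {w : ℝ} (hw : w < 1) :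
    ∃ k : ℕ, w ≤ distFun μ k := by
  have h := tendsto_measure_iUnion_atTop (μ := μ) (s := fun k : ℕ => Set.Iic (k : ℝ))
    (fun a b hab => Set.Iic_subset_Iic.2 (by simpa using hab))
  have hU : ⋃ k : ℕ, Set.Iic (k : ℝ) = Set.univ := by
    ext x; simpa using exists_nat_ge x
  rw [hU, measure_univ] at h
  have h1 := (ENNReal.tendsto_toReal ENNReal.one_ne_top).comp h
  obtain ⟨k, hk⟩ := (h1.eventually (lt_mem_nhds (by simpa using hw))).exists
  exact ⟨k, le_of_lt hk⟩

theorem quantile_le_iff_le_distFun (μ : Measure ℝ) [IsProbabilityMeasure μ] {w t : ℝ}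
    (hw : w ∈ Set.Ioo (0 : ℝ) 1) : quantile μ w ≤ t ↔ w ≤ distFun μ t :=
  quantile_le_iff μ hw.1 (exists_nat_le_distFun μ hw.2)

theorem measurable_quantile_fixed (μ : Measure ℝ) [IsFiniteMeasure μ] :
    Measurable (quantile μ) :=
  (measurable_quantile (α := Unit) (κ := fun _ => μ) measurable_const).comp
    (measurable_prodMk_left (x := ()))

instance : IsProbabilityMeasure (volume.restrict (Set.Ioo (0 : ℝ) 1)) := ⟨by simp⟩

/-- Inverse transform sampling: on (0, 1) the Galois connection between quantile and distribution
function turns the preimage of (-∞, t] into the levels at most F_μ(t), a set of length F_μ(t). -/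
theorem map_quantile (μ : Measure ℝ) [IsProbabilityMeasure μ] :
    (volume.restrict (Set.Ioo (0 : ℝ) 1)).map (quantile μ) = μ := by
  have hm := measurable_quantile_fixed μ
  have : IsProbabilityMeasure ((volume.restrict (Set.Ioo (0 : ℝ) 1)).map (quantile μ)) :=
    Measure.isProbabilityMeasure_map hm.aemeasurable
  refine Measure.ext_of_Iic _ _ fun t => ?_
  rw [Measure.map_apply hm measurableSet_Iic, Measure.restrict_apply (hm measurableSet_Iic)]
  have h0 : 0 ≤ distFun μ t := measureReal_nonneg
  have h1 : distFun μ t ≤ 1 := measureReal_le_one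
  have e : (quantile μ ⁻¹' Set.Iic t ∩ Set.Ioo 0 1 : Set ℝ) =
      Set.Iic (distFun μ t) ∩ Set.Ioo 0 1 := by
    ext w
    constructor
    · rintro ⟨a, b⟩; exact ⟨(quantile_le_iff_le_distFun μ b).1 a, b⟩
    · rintro ⟨a, b⟩; exact ⟨(quantile_le_iff_le_distFun μ b).2 a, b⟩
  rw [e]
  have hv : volume (Set.Iic (distFun μ t) ∩ Set.Ioo 0 1 : Set ℝ) =
      ENNReal.ofReal (distFun μ t) := by
    refine le_antisymm ?_ ?_
    · refine (measure_mono (t := Set.Icc 0 (distFun μ t)) ?_).trans (by simp)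
      rintro w ⟨a, b⟩; exact ⟨b.1.le, a⟩
    · refine le_trans (by simp) (measure_mono (s := Set.Ioo 0 (distFun μ t)) ?_)
      rintro w ⟨a, b⟩; exact ⟨b.le, a, b.trans_le h1⟩
  rw [hv, distFun, ofReal_measureReal]

/-! ### The Feynman-Kac flow -/

theorem abs_apply_le_norm {X : Type*} [TopologicalSpace X] (h : X →ᵇ ℝ) (x : X) :
    |h x| ≤ ‖h‖ := h.norm_coe_le_norm x

/-- The action of a Feller Markov kernel on bounded continuous functions. -/
def fellerMap {X : Type*} [TopologicalSpace X] [MeasurableSpace X] (κ : Kernel X X)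
    [IsMarkovKernel κ] (hκ : IsFeller κ) (h : X →ᵇ ℝ) : X →ᵇ ℝ :=
  BoundedContinuousFunction.ofNormedAddCommGroup (fun x => ∫ y, h y ∂(κ x)) (hκ h) ‖h‖
    fun _ => abs_integral_le_of_abs_le (abs_apply_le_norm h)

theorem integrable_bcf {X : Type*} [TopologicalSpace X] [MeasurableSpace X]
    [OpensMeasurableSpace X] (l : Measure X) [IsFiniteMeasure l] (h : X →ᵇ ℝ) :
    Integrable (fun x => h x) l :=
  integrable_of_abs_le h.continuous.measurable (abs_apply_le_norm h)

section Flow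

set_option linter.unusedSectionVars false

variable (η₀ : Measure ℝ) [IsProbabilityMeasure η₀] (M : ℕ → Kernel ℝ ℝ)
  [∀ n, IsMarkovKernel (M n)] (G : ℕ → ℝ →ᵇ ℝ) (hG : ∀ n x, 0 ≤ G n x)
  (hpos : ∀ n, 0 < ∫ x, G n x ∂(predictor η₀ M (fun k => G k) n))

include hG hpos in
theorem lintegral_potential (n : ℕ) (hp : IsProbabilityMeasure (predictor η₀ M (fun k => G k) n)) :
    ∫⁻ x, ENNReal.ofReal (G n x) ∂(predictor η₀ M (fun k => G k) n) =
      ENNReal.ofReal (∫ x, G n x ∂(predictor η₀ M (fun k => G k) n)) :=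
  (ofReal_integral_eq_lintegral_ofReal (integrable_bcf _ (G n)) (ae_of_all _ (hG n))).symm

include hG hpos in
-- The mass satisfies γ_{n+1}(1) = γ_n(G_n) = γ_n(1) η_n(G_n), so positivity and finiteness
-- propagate in time.
theorem gammaM_univ (n : ℕ) : gammaM η₀ M (fun k => G k) n Set.univ ≠ 0 ∧
    gammaM η₀ M (fun k => G k) n Set.univ ≠ ∞ := by
  induction n with
  | zero => simp [gammaM]
  | succ n ih =>
    have hp : IsProbabilityMeasure (predictor η₀ M (fun k => G k) n) :=
      ⟨by simp [predictor, ENNReal.inv_mul_cancel ih.1 ih.2]⟩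
    have e := lintegral_potential η₀ M G hG hpos n hp
    rw [predictor, lintegral_smul_measure, smul_eq_mul, ← predictor] at e
    have e1 : gammaM η₀ M (fun k => G k) (n + 1) Set.univ =
        ∫⁻ x, ENNReal.ofReal (G n x) ∂(gammaM η₀ M (fun k => G k) n) := by
      rw [gammaM, Measure.bind_apply MeasurableSet.univ (Kernel.aemeasurable _)]
      simp
    rw [e1]
    have h0 : ENNReal.ofReal (∫ x, G n x ∂(predictor η₀ M (fun k => G k) n)) ≠ 0 := by
      simpa using hpos n
    constructor
    · intro h
      rw [h, mul_zero] at e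
      exact h0 e.symm
    · intro h
      rw [h, ENNReal.mul_top (ENNReal.inv_ne_zero.2 ih.2)] at e
      exact ENNReal.ofReal_ne_top e.symm

include hG hpos in
theorem isProbabilityMeasure_predictor (n : ℕ) :
    IsProbabilityMeasure (predictor η₀ M (fun k => G k) n) :=
  ⟨by
    have h := gammaM_univ η₀ M G hG hpos n
    simp [predictor, ENNReal.inv_mul_cancel h.1 h.2]⟩

include hG hpos in
theorem isProbabilityMeasure_filterM (n : ℕ) :
    IsProbabilityMeasure (filterM η₀ M (fun k => G k) n) := by
  constructor
  have hp := isProbabilityMeasure_predictor η₀ M G hG hpos n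
  have e := lintegral_potential η₀ M G hG hpos n hp
  simp only [filterM, Measure.smul_apply, withDensity_apply _ MeasurableSet.univ,
    Measure.restrict_univ, smul_eq_mul]
  rw [e]
  exact ENNReal.inv_mul_cancel (by simpa using hpos n) ENNReal.ofReal_ne_top

include hG hpos in
theorem integral_filterM (n : ℕ) (h : ℝ → ℝ) :
    ∫ x, h x ∂(filterM η₀ M (fun k => G k) n) =
      (∫ x, G n x * h x ∂(predictor η₀ M (fun k => G k) n)) /
        ∫ x, G n x ∂(predictor η₀ M (fun k => G k) n) := by
  have hp := isProbabilityMeasure_predictor η₀ M G hG hpos n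
  rw [filterM, lintegral_potential η₀ M G hG hpos n hp, integral_smul_measure,
    integral_withDensity_eq_integral_toReal_smul
      ((G n).continuous.measurable.ennreal_ofReal) (by simp)]
  simp only [ENNReal.toReal_inv, ENNReal.toReal_ofReal (hpos n).le, smul_eq_mul,
    ENNReal.toReal_ofReal (hG n _)]
  rw [inv_mul_eq_div]

include hG hpos in
-- The mass γ_n(1) cancels between the normalisations of γ_{n+1} and of the filter.
theorem predictor_succ (n : ℕ) : predictor η₀ M (fun k => G k) (n + 1) =
    M (n + 1) ∘ₘ filterM η₀ M (fun k => G k) n := by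
  have h := gammaM_univ η₀ M G hG hpos n
  have e1 : gammaM η₀ M (fun k => G k) (n + 1) Set.univ =
      ∫⁻ x, ENNReal.ofReal (G n x) ∂(gammaM η₀ M (fun k => G k) n) := by
    rw [gammaM, Measure.bind_apply MeasurableSet.univ (Kernel.aemeasurable _)]
    simp
  rw [predictor, e1, gammaM, filterM, predictor, lintegral_smul_measure,
    withDensity_smul_measure, smul_smul, Measure.comp_smul, smul_eq_mul,
    ENNReal.mul_inv (Or.inl (ENNReal.inv_ne_zero.2 h.2)) (Or.inl (ENNReal.inv_ne_top.2 h.1)),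
    inv_inv, mul_right_comm, ENNReal.mul_inv_cancel h.1 h.2, one_mul]

theorem predictor_zero : predictor η₀ M (fun k => G k) 0 = η₀ := by
  simp [predictor, gammaM]

variable (hF : ∀ n, 1 ≤ n → IsFeller (M n))

include hG hpos in
theorem integral_predictor_succ (n : ℕ) (h : ℝ →ᵇ ℝ) :
    ∫ x, h x ∂(predictor η₀ M (fun k => G k) (n + 1)) =
      ∫ x, ∫ y, h y ∂(M (n + 1) x) ∂(filterM η₀ M (fun k => G k) n) := by
  have hp := isProbabilityMeasure_predictor η₀ M G hG hpos (n + 1)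
  have hi := integrable_bcf (predictor η₀ M (fun k => G k) (n + 1)) h
  rw [predictor_succ η₀ M G hG hpos] at hi ⊢
  exact integral_comp_measure hi

/-- The function `G_n (k - η̄_n(k)) / η_n(G_n)`, the first order term of the fluctuations of the
weighted averages of `k` around `η̄_n(k)`. -/
def linearize (n : ℕ) (k : ℝ →ᵇ ℝ) : ℝ →ᵇ ℝ :=
  (∫ x, G n x ∂(predictor η₀ M (fun k => G k) n))⁻¹ •
    (G n * (k - BoundedContinuousFunction.const ℝ (∫ x, k x ∂(filterM η₀ M (fun k => G k) n))))

theorem linearize_apply (n : ℕ) (k : ℝ →ᵇ ℝ) (x : ℝ) : linearize η₀ M G n k x =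
    G n x * (k x - ∫ x, k x ∂(filterM η₀ M (fun k => G k) n)) /
      ∫ x, G n x ∂(predictor η₀ M (fun k => G k) n) := by
  rw [div_eq_inv_mul]; rfl

include hG hpos in
theorem integral_linearize (n : ℕ) (k : ℝ →ᵇ ℝ) :
    ∫ x, linearize η₀ M G n k x ∂(predictor η₀ M (fun k => G k) n) = 0 := by
  have hp := isProbabilityMeasure_predictor η₀ M G hG hpos n
  have hf := isProbabilityMeasure_filterM η₀ M G hG hpos n
  simp_rw [linearize_apply]
  rw [integral_div, ← integral_filterM η₀ M G hG hpos,
    integral_sub (integrable_bcf _ k) (integrable_const _)]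
  simp

/-- The function `φ' = G_n (M_{n+1}(φ) - η_{n+1}(φ)) / η_n(G_n)` that carries the fluctuations
at time `n + 1` of `φ` back to time `n`. -/
def pullback (n : ℕ) (h : ℝ →ᵇ ℝ) : ℝ →ᵇ ℝ :=
  linearize η₀ M G n (fellerMap (M (n + 1)) (hF (n + 1) (by omega)) h)

include hG hpos in
theorem pullback_apply (n : ℕ) (h : ℝ →ᵇ ℝ) (x : ℝ) : pullback η₀ M G hF n h x =
    G n x * ((∫ y, h y ∂(M (n + 1) x)) - ∫ x, h x ∂(predictor η₀ M (fun k => G k) (n + 1))) /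
      ∫ x, G n x ∂(predictor η₀ M (fun k => G k) n) := by
  rw [pullback, linearize_apply, integral_predictor_succ η₀ M G hG hpos]
  rfl

include hG hpos in
theorem integral_pullback (n : ℕ) (h : ℝ →ᵇ ℝ) :
    ∫ x, pullback η₀ M G hF n h x ∂(predictor η₀ M (fun k => G k) n) = 0 :=
  integral_linearize η₀ M G hG hpos n _

/-- The definition peels off the first factor of Q_{p,n}, whereas the induction on the final time
has to peel off the last one. -/
theorem semigroupQ_succ_right (g : ℕ → ℝ → ℝ) (k p : ℕ) (h : ℝ → ℝ) :
    semigroupQ M g (k + 1) p h =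
      semigroupQ M g k p fun x => g (p + k) x * ∫ y, h y ∂(M (p + k + 1) x) := by
  induction k generalizing p with
  | zero => rfl
  | succ k ih =>
    have e := ih (p + 1)
    ext x
    rw [semigroupQ, e, semigroupQ]
    simp only [add_assoc, add_comm 1 k]

theorem semigroupQ_const_mul (g : ℕ → ℝ → ℝ) (k p : ℕ) (h : ℝ → ℝ) (c : ℝ) :
    semigroupQ M g k p (fun x => c * h x) = fun x => c * semigroupQ M g k p h x := by
  induction k generalizing p with
  | zero => rfl
  | succ k ih =>
    ext x
    simp only [semigroupQ, ih, integral_const_mul]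
    ring

include hG hpos hF in
-- This is γ_p Q_{p,p+k} = γ_{p+k} after normalisation. Peeling the last factor both for `h` and for
-- 1 produces the same constant η_{p+k}(G_{p+k}), which cancels in the ratio.
theorem integral_semigroupQ (k p : ℕ) (h : ℝ →ᵇ ℝ) :
    ∫ x, semigroupQ M (fun k => G k) k p h x ∂(predictor η₀ M (fun k => G k) p) =
      (∫ x, h x ∂(predictor η₀ M (fun k => G k) (p + k))) *
        ∫ x, semigroupQ M (fun k => G k) k p (fun _ => 1) x ∂(predictor η₀ M (fun k => G k) p) := by
  induction k generalizing h with
  | zero =>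
    have hp := isProbabilityMeasure_predictor η₀ M G hG hpos p
    simp [semigroupQ]
  | succ k ih =>
    have e1 : ∀ h : ℝ →ᵇ ℝ, semigroupQ M (fun k => G k) (k + 1) p h =
        semigroupQ M (fun k => G k) k p
          (G (p + k) * fellerMap (M (p + k + 1)) (hF _ (by omega)) h : ℝ →ᵇ ℝ) := fun h =>
      semigroupQ_succ_right M _ k p h
    have e2 : semigroupQ M (fun k => G k) (k + 1) p (fun _ => 1) =
        semigroupQ M (fun k => G k) k p (G (p + k)) := by
      rw [semigroupQ_succ_right]; simp
    rw [e1, e2, ih, ih, ← add_assoc, integral_predictor_succ η₀ M G hG hpos,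
      integral_filterM η₀ M G hG hpos, ← mul_assoc, div_mul_cancel₀ _ (hpos _).ne']
    rfl

theorem operatorD_self (n : ℕ) (h : ℝ → ℝ) (x : ℝ) (g : ℕ → ℝ → ℝ)
    (hp : IsProbabilityMeasure (predictor η₀ M g n)) :
    operatorD η₀ M g n n h x = h x - ∫ z, h z ∂(predictor η₀ M g n) := by
  simp [operatorD, semigroupQ]

include hG hpos in
-- This drives the recursion for the variance. Numerator and denominator of D_{p,n+1}(h) both
-- acquire the factor η_n(G_n): the former since G_n (M_{n+1}h - η_{n+1}(h)) = η_n(G_n) h', the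
-- latter since η_p(Q_{p,n}(G_n)) = η_n(G_n) η_p(Q_{p,n}(1)). As h' already has mean zero under η_n,
-- the centring inside D_{p,n}(h') does nothing.
theorem operatorD_succ {p n : ℕ} (hpn : p ≤ n) (h : ℝ →ᵇ ℝ) :
    operatorD η₀ M (fun k => G k) p (n + 1) h =
      operatorD η₀ M (fun k => G k) p n (pullback η₀ M G hF n h) := by
  obtain ⟨k, rfl⟩ := Nat.exists_eq_add_of_le hpn
  ext x
  have e2 : semigroupQ M (fun k => G k) (k + 1) p (fun _ => 1) =
      semigroupQ M (fun k => G k) k p (G (p + k)) := by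
    rw [semigroupQ_succ_right]; simp
  set y := ∫ x, G (p + k) x ∂(predictor η₀ M (fun k => G k) (p + k)) with hy
  have e3 : semigroupQ M (fun k => G k) (k + 1) p (fun y => h y -
      ∫ z, h z ∂(predictor η₀ M (fun k => G k) (p + k + 1))) =
      fun x => y * semigroupQ M (fun k => G k) k p (pullback η₀ M G hF (p + k) h) x := by
    rw [semigroupQ_succ_right, ← semigroupQ_const_mul]
    congr 1 with x
    rw [pullback_apply η₀ M G hG hpos, integral_sub (integrable_bcf _ h) (integrable_const _), ← hy,
      mul_div_cancel₀ _ (hpos _).ne']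
    simp
  rw [operatorD, operatorD, integral_pullback η₀ M G hG hpos, show p + k + 1 - p = k + 1 by omega,
    show p + k - p = k by omega, e2, e3, integral_semigroupQ η₀ M G hG hpos hF, ← hy]
  simp only [sub_zero]
  rw [mul_div_mul_left _ _ (hpos _).ne']

end Flow

/-! ### Marginals of the couplings -/

/-- A coordinate of the coupled mutation evolves autonomously, because its transition law depends on
`u` only through `c u`. -/
theorem map_comp_eq_of_marginal {X : Type*} [MeasurableSpace X] {c : X → ℝ} (hc : Measurable c)
    {MW : Kernel X X} {M : Kernel ℝ ℝ}
    (hM : ∀ u, (MW u).map c = M (c u)) (ν : Measure X) :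
    (MW ∘ₘ ν).map c = M ∘ₘ ν.map c := by
  rw [Measure.map_comp _ _ hc]
  ext s hs
  rw [Measure.bind_apply hs (Kernel.aemeasurable _), Measure.bind_apply hs (Kernel.aemeasurable _),
    lintegral_map (Kernel.measurable_coe _ hs) hc]
  simp_rw [Kernel.map_apply _ hc, hM]

theorem integral_marginal {X : Type*} [MeasurableSpace X] {c : X → ℝ} (hc : Measurable c)
    {l : Measure X} {m : Measure ℝ} (hm : l.map c = m) (h : ℝ →ᵇ ℝ) :
    ∫ u, h (c u) ∂l = ∫ x, h x ∂m := by
  rw [← hm, integral_map hc.aemeasurable h.continuous.measurable.aestronglyMeasurable]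

theorem map_fst_quantileCoupling (μ ν : Measure ℝ) [IsFiniteMeasure μ] [IsFiniteMeasure ν] :
    (quantileCoupling μ ν).map Prod.fst =
      (volume.restrict (Set.Ioo (0 : ℝ) 1)).map (quantile μ) := by
  rw [quantileCoupling, Measure.map_map measurable_fst
    ((measurable_quantile_fixed μ).prodMk (measurable_quantile_fixed ν))]
  rfl

theorem map_snd_quantileCoupling (μ ν : Measure ℝ) [IsFiniteMeasure μ] [IsFiniteMeasure ν] :
    (quantileCoupling μ ν).map Prod.snd =
      (volume.restrict (Set.Ioo (0 : ℝ) 1)).map (quantile ν) := by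
  rw [quantileCoupling, Measure.map_map measurable_snd
    ((measurable_quantile_fixed μ).prodMk (measurable_quantile_fixed ν))]
  rfl

theorem isProbabilityMeasure_quantileCoupling (μ ν : Measure ℝ) [IsFiniteMeasure μ]
    [IsFiniteMeasure ν] : IsProbabilityMeasure (quantileCoupling μ ν) :=
  Measure.isProbabilityMeasure_map
    ((measurable_quantile_fixed μ).prodMk (measurable_quantile_fixed ν)).aemeasurable

/-! ### Time marginals of the particle system -/

/-- The marginal law of the `N` pairs of particles at time `n`. -/
def particleMarginal (η₀W : Measure (ℝ × ℝ)) (MW : ℕ → Kernel (ℝ × ℝ) (ℝ × ℝ))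
    [∀ n, IsMarkovKernel (MW n)] (G : ℕ → ℝ →ᵇ ℝ) (N : ℕ) : ℕ → Measure (Fin N → ℝ × ℝ)
  | 0 => Measure.pi fun _ => η₀W
  | n + 1 => step MW G N n ∘ₘ particleMarginal η₀W MW G N n

instance (η₀W : Measure (ℝ × ℝ)) [IsProbabilityMeasure η₀W] (MW : ℕ → Kernel (ℝ × ℝ) (ℝ × ℝ))
    [∀ n, IsMarkovKernel (MW n)] (G : ℕ → ℝ →ᵇ ℝ) (N n : ℕ) :
    IsProbabilityMeasure (particleMarginal η₀W MW G N n) := by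
  induction n with
  | zero => unfold particleMarginal; infer_instance
  | succ n ih => unfold particleMarginal; infer_instance

instance (η₀W : Measure (ℝ × ℝ)) [IsProbabilityMeasure η₀W] (MW : ℕ → Kernel (ℝ × ℝ) (ℝ × ℝ))
    [∀ n, IsMarkovKernel (MW n)] (G : ℕ → ℝ →ᵇ ℝ) (N : ℕ) :
    IsProbabilityMeasure (particleLaw η₀W MW G N) := by
  unfold particleLaw; infer_instance

/-- The limit theorem concerns a single time, so the trajectory measure enters only through its
one-time marginals, and these satisfy the Markov recursion. -/
theorem map_eval_particleLaw (η₀W : Measure (ℝ × ℝ)) [IsProbabilityMeasure η₀W]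
    (MW : ℕ → Kernel (ℝ × ℝ) (ℝ × ℝ)) [∀ n, IsMarkovKernel (MW n)] (G : ℕ → ℝ →ᵇ ℝ) (N n : ℕ) :
    (particleLaw η₀W MW G N).map (fun x => x n) = particleMarginal η₀W MW G N n := by
  induction n with
  | zero =>
    have e : (fun x : ℕ → Fin N → ℝ × ℝ => x 0) =
        (fun y : (i : Finset.Iic 0) → Fin N → ℝ × ℝ => y ⟨0, Finset.mem_Iic.2 le_rfl⟩) ∘
          Preorder.frestrictLe (π := fun _ => Fin N → ℝ × ℝ) 0 := rfl
    rw [e, ← Measure.map_map (by fun_prop) (by fun_prop), particleLaw, Kernel.trajMeasure,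
      Measure.map_comp _ _ (by fun_prop), Kernel.traj_map_frestrictLe, Kernel.partialTraj_self,
      Measure.id_comp, Measure.map_map (by fun_prop) (by fun_prop)]
    exact Measure.map_id
  | succ n ih =>
    have h := Kernel.map_frestrictLe_trajMeasure_compProd_eq_map_trajMeasure
      (X := fun _ => Fin N → ℝ × ℝ) (μ₀ := Measure.pi fun _ => η₀W)
      (κ := fun p => (step MW G N p).comap (fun h : (i : Finset.Iic p) → Fin N → ℝ × ℝ =>
        h ⟨p, Finset.mem_Iic.2 le_rfl⟩) (measurable_pi_apply _)) (a := n)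
    rw [← particleLaw] at h
    have h2 := congrArg Measure.snd h
    have := Measure.isProbabilityMeasure_map (μ := particleLaw η₀W MW G N)
      (f := Preorder.frestrictLe (π := fun _ => Fin N → ℝ × ℝ) n) (by fun_prop)
    rw [Measure.snd_compProd, Measure.snd, Measure.map_map measurable_snd (by fun_prop)] at h2
    rw [particleMarginal, ← ih]
    refine Eq.trans h2.symm ?_
    rw [← Kernel.comp_deterministic_eq_comap, ← Measure.comp_assoc,
      Measure.deterministic_comp_eq_map, Measure.map_map (by fun_prop) (by fun_prop)]
    rfl

/-! ### One coordinate of the particle system: rates in mean square -/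

theorem measurable_integral_kernel {α β : Type*} [MeasurableSpace α] [MeasurableSpace β]
    (κ : Kernel α β) [IsSFiniteKernel κ] {f : β → ℝ} (hf : Measurable f) :
    Measurable fun a => ∫ b, f b ∂(κ a) :=
  hf.stronglyMeasurable.integral_kernel.measurable

/-- The conditional law of each pair at time `n + 1` given the pairs at time `n`. -/
def mutationLaw (MW : ℕ → Kernel (ℝ × ℝ) (ℝ × ℝ)) (G : ℕ → ℝ →ᵇ ℝ) (N n : ℕ) :
    Kernel (Fin N → ℝ × ℝ) (ℝ × ℝ) :=
  MW (n + 1) ∘ₖ resample (G n) (G n).continuous.measurable N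

instance (MW : ℕ → Kernel (ℝ × ℝ) (ℝ × ℝ)) [∀ n, IsMarkovKernel (MW n)] (G : ℕ → ℝ →ᵇ ℝ)
    (N n : ℕ) : IsMarkovKernel (mutationLaw MW G N n) := by
  unfold mutationLaw; infer_instance

theorem step_apply (MW : ℕ → Kernel (ℝ × ℝ) (ℝ × ℝ)) [∀ n, IsMarkovKernel (MW n)]
    (G : ℕ → ℝ →ᵇ ℝ) (N n : ℕ) (u : Fin N → ℝ × ℝ) :
    step MW G N n u = Measure.pi fun _ => mutationLaw MW G N n u := rfl

theorem mutationLaw_apply (MW : ℕ → Kernel (ℝ × ℝ) (ℝ × ℝ)) (G : ℕ → ℝ →ᵇ ℝ) (N n : ℕ)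
    (u : Fin N → ℝ × ℝ) : mutationLaw MW G N n u =
      MW (n + 1) ∘ₘ resample (G n) (G n).continuous.measurable N u :=
  Kernel.comp_apply _ _ _

theorem integral_weightedEmpirical {g : ℝ → ℝ} (hg : ∀ x, 0 ≤ g x) {N : ℕ} (x : Fin N → ℝ)
    {h : ℝ → ℝ} (hh : Measurable h) :
    ∫ y, h y ∂(weightedEmpirical g x) = avg x (fun y => g y * h y) / avg x g := by
  have hi : ∀ i ∈ Finset.univ, Integrable h
      (ENNReal.ofReal (g (x i) / ∑ j, g (x j)) • Measure.dirac (x i)) := fun i _ =>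
    (integrable_dirac' hh.stronglyMeasurable (by simp)).smul_measure ENNReal.ofReal_ne_top
  rw [weightedEmpirical, integral_finsetSum_measure hi]
  have h0 : 0 ≤ ∑ j, g (x j) := Finset.sum_nonneg fun j _ => hg _
  simp_rw [integral_smul_measure, ENNReal.toReal_ofReal (div_nonneg (hg _) h0),
    integral_dirac' _ _ hh.stronglyMeasurable, smul_eq_mul, div_mul_eq_mul_div]
  rw [← Finset.sum_div, avg, avg]
  rcases Nat.eq_zero_or_pos N with rfl | hN
  · simp
  · have : (N : ℝ) ≠ 0 := by exact_mod_cast hN.ne'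
    rw [mul_div_mul_left _ _ (inv_ne_zero this)]

theorem isProbabilityMeasure_weightedEmpirical {g : ℝ → ℝ} (hg : ∀ x, 0 ≤ g x) {N : ℕ}
    (x : Fin N → ℝ) (h : 0 < avg x g) : IsProbabilityMeasure (weightedEmpirical g x) := by
  constructor
  have e := integral_weightedEmpirical hg x (h := fun _ => 1) measurable_const
  simp only [mul_one, integral_const, smul_eq_mul] at e
  rw [div_self h.ne'] at e
  rw [← ENNReal.ofReal_toReal (measure_ne_top (weightedEmpirical g x) Set.univ)]
  rw [measureReal_def] at e
  rw [e]; simp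

/-- The disjunction on `c` lets a single argument treat the fine and the coarse coordinate. The
right side is kept as an image of the uniform law, so that it also covers vanishing weights, where
it is a point mass at 0. -/
theorem map_resample {c : ℝ × ℝ → ℝ} (hc : c = Prod.fst ∨ c = Prod.snd) (g : ℝ → ℝ)
    (hg : Measurable g) (N : ℕ) (u : Fin N → ℝ × ℝ) :
    (resample g hg N u).map c = (volume.restrict (Set.Ioo (0 : ℝ) 1)).map
      (quantile (weightedEmpirical g fun i => c (u i))) := by
  rcases hc with rfl | rfl
  · exact map_fst_quantileCoupling _ _
  · exact map_snd_quantileCoupling _ _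

theorem integrable_sq_avg_sub {X : Type*} [MeasurableSpace X] {N : ℕ}
    (l : Measure (Fin N → X)) [IsFiniteMeasure l] {f : X → ℝ} (hf : Measurable f) {K : ℝ}
    (hK0 : 0 ≤ K) (hK : ∀ x, |f x| ≤ K) (c : ℝ) :
    Integrable (fun u => (avg u f - c) ^ 2) l := by
  refine integrable_of_abs_le (((measurable_avg hf).sub_const c).pow_const 2) (K := (K + |c|) ^ 2)
    fun u => ?_
  rw [abs_pow]
  gcongr
  exact (abs_sub _ _).trans (by gcongr; exact abs_avg_le u hK0 hK)

section Coordinate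

set_option linter.unusedSectionVars false

variable (η₀ : Measure ℝ) [IsProbabilityMeasure η₀] (M : ℕ → Kernel ℝ ℝ)
  [∀ n, IsMarkovKernel (M n)] (G : ℕ → ℝ →ᵇ ℝ) (hG : ∀ n x, 0 ≤ G n x)
  (hpos : ∀ n, 0 < ∫ x, G n x ∂(predictor η₀ M (fun k => G k) n))

include hpos in
/-- Linearisation of the weighted averages, with an error of second order. -/
theorem exists_ratio_bound (n : ℕ) (k : ℝ →ᵇ ℝ) (K : ℝ) : ∃ C, 0 ≤ C ∧
    ∀ (N : ℕ) (x : Fin N → ℝ) (b : ℝ), 0 < N → |b| ≤ K →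
      (0 < avg x (G n) → b = avg x (fun y => G n y * k y) / avg x (G n) -
        ∫ x, k x ∂(filterM η₀ M (fun k => G k) n)) →
      |b - avg x (linearize η₀ M G n k)| ≤ C * (avg x (linearize η₀ M G n k) ^ 2 +
          (avg x (G n) - ∫ x, G n x ∂(predictor η₀ M (fun k => G k) n)) ^ 2) ∧
      b ^ 2 ≤ C * (avg x (linearize η₀ M G n k) ^ 2 +
          (avg x (G n) - ∫ x, G n x ∂(predictor η₀ M (fun k => G k) n)) ^ 2) := by
  set y₀ := ∫ x, G n x ∂(predictor η₀ M (fun k => G k) n) with hy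
  have hy₀ : 0 < y₀ := hpos n
  set κ := ∫ x, k x ∂(filterM η₀ M (fun k => G k) n) with hκ
  set ψ := linearize η₀ M G n k with hψ
  -- A common bound for `b` and for the numerator y₀ a, as the ratio estimate requires.
  set K' := max K 0 + y₀ * ‖ψ‖ with hK'
  have hK0 : 0 ≤ max K 0 := le_max_right _ _
  have hK'0 : 0 ≤ K' := by positivity
  set C₀ := 2 / y₀ ^ 2 + 4 * K' * (1 + 1 / y₀) / y₀ ^ 2 with hC₀
  have hC₀0 : 0 ≤ C₀ := by positivity
  set C₁ := C₀ * (1 + y₀ ^ 2) with hC₁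
  have hC₁0 : 0 ≤ C₁ := by positivity
  -- C₁ serves the linearisation error; the bracket serves b² ≤ 2a² + 2(b - a)², where one factor |b
  -- - a| is bounded crudely and the other by the linearisation error.
  refine ⟨C₁ + (2 + 2 * (max K 0 + ‖ψ‖) * C₁), by positivity, fun N x b hN hb hr => ?_⟩
  have hb' : |b| ≤ max K 0 := hb.trans (le_max_left _ _)
  set a := avg x ψ with ha
  set d := avg x (G n) with hd
  have haψ : |a| ≤ ‖ψ‖ := abs_avg_le x (norm_nonneg _) (abs_apply_le_norm ψ)
  -- y₀ a is exactly the numerator of the difference between the ratio and its limit κ, so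
  -- linearising only means replacing the denominator d by y₀.
  have hya : y₀ * a = avg x (fun y => G n y * k y) - d * κ := by
    rw [ha, mul_comm, ← avg_mul_const, hd, ← avg_mul_const, ← avg_sub]
    congr 1 with y
    rw [hψ, linearize_apply, ← hy, ← hκ, div_mul_cancel₀ _ hy₀.ne']
    ring
  have h1 := abs_ratio_sub_le (b := b) (x := y₀ * a) (y := d) (K := K') hy₀
    (hb'.trans (le_add_of_nonneg_right (by positivity)))
    (by
      rw [abs_mul, abs_of_pos hy₀]
      exact (mul_le_mul_of_nonneg_left haψ hy₀.le).trans (le_add_of_nonneg_left hK0))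
    (fun h => by rw [hr h, hya]; field_simp)
  rw [mul_div_cancel_left₀ _ hy₀.ne', ← hC₀] at h1
  have h2 : |b - a| ≤ C₁ * (a ^ 2 + (d - y₀) ^ 2) := by
    refine h1.trans ?_
    rw [hC₁, mul_assoc]
    gcongr
    nlinarith [sq_nonneg a, sq_nonneg (y₀ * (d - y₀))]
  have hS : 0 ≤ a ^ 2 + (d - y₀) ^ 2 := by positivity
  constructor
  · refine h2.trans ?_
    gcongr
    have : 0 ≤ 2 * (max K 0 + ‖ψ‖) * C₁ := by positivity
    linarith
  · have h3 : |b - a| ≤ max K 0 + ‖ψ‖ := (abs_sub _ _).trans (add_le_add hb' haψ)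
    have h4 : (b - a) ^ 2 ≤ (max K 0 + ‖ψ‖) * (C₁ * (a ^ 2 + (d - y₀) ^ 2)) := by
      rw [← sq_abs, sq]
      exact mul_le_mul h3 h2 (abs_nonneg _) (by positivity)
    have h5 : b ^ 2 ≤ 2 * a ^ 2 + 2 * (b - a) ^ 2 := by nlinarith [sq_nonneg (b - 2 * a)]
    have h6 : 0 ≤ C₁ * (a ^ 2 + (d - y₀) ^ 2) := by positivity
    nlinarith [sq_nonneg (d - y₀)]

variable (hF : ∀ n, 1 ≤ n → IsFeller (M n)) (η₀W : Measure (ℝ × ℝ)) [IsProbabilityMeasure η₀W]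
  (MW : ℕ → Kernel (ℝ × ℝ) (ℝ × ℝ)) [∀ n, IsMarkovKernel (MW n)] {c : ℝ × ℝ → ℝ}
  (hc : c = Prod.fst ∨ c = Prod.snd) (hη : η₀W.map c = η₀)
  (hM : ∀ n, 1 ≤ n → ∀ u : ℝ × ℝ, (MW n u).map c = M n (c u))

include hc in
theorem measurable_coordinate : Measurable c := by
  rcases hc with rfl | rfl
  · exact measurable_fst
  · exact measurable_snd

include hF hc hM in
theorem integral_mutationLaw (n N : ℕ) (h : ℝ →ᵇ ℝ) (u : Fin N → ℝ × ℝ) :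
    ∫ v, h (c v) ∂(mutationLaw MW G N n u) =
      ∫ w, fellerMap (M (n + 1)) (hF (n + 1) (by omega)) h w
        ∂((volume.restrict (Set.Ioo (0 : ℝ) 1)).map
          (quantile (weightedEmpirical (G n) fun i => c (u i)))) := by
  have hcm := measurable_coordinate hc
  have e := map_comp_eq_of_marginal hcm (hM (n + 1) (by omega))
    (resample (G n) (G n).continuous.measurable N u)
  rw [map_resample hc] at e
  have : IsProbabilityMeasure ((volume.restrict (Set.Ioo (0 : ℝ) 1)).map
      (quantile (weightedEmpirical (G n) fun i => c (u i)))) :=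
    Measure.isProbabilityMeasure_map (measurable_quantile_fixed _).aemeasurable
  rw [mutationLaw_apply, integral_marginal hcm e,
    integral_comp_measure (integrable_bcf _ h)]
  rfl

include hG hF hc hM in
theorem integral_mutationLaw_of_pos (n N : ℕ) (h : ℝ →ᵇ ℝ) (u : Fin N → ℝ × ℝ)
    (hp : 0 < avg (fun i => c (u i)) (G n)) :
    ∫ v, h (c v) ∂(mutationLaw MW G N n u) =
      avg (fun i => c (u i)) (fun y => G n y *
        fellerMap (M (n + 1)) (hF (n + 1) (by omega)) h y) / avg (fun i => c (u i)) (G n) := by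
  have := isProbabilityMeasure_weightedEmpirical (hG n) (fun i => c (u i)) hp
  rw [integral_mutationLaw M G hF MW hc hM, map_quantile, integral_weightedEmpirical (hG n)]
  exact (fellerMap _ _ h).continuous.measurable

include hG hpos hF hc hM in
/-- Linearisation of the conditional bias of a coordinate. -/
theorem exists_bias_bound (n : ℕ) (h : ℝ →ᵇ ℝ) : ∃ C, 0 ≤ C ∧
    ∀ (N : ℕ) (u : Fin N → ℝ × ℝ), 0 < N →
      |(∫ v, h (c v) ∂(mutationLaw MW G N n u)) -
          (∫ x, h x ∂(predictor η₀ M (fun k => G k) (n + 1))) -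
          avg u (fun v => pullback η₀ M G hF n h (c v))| ≤
        C * ((avg u fun v => pullback η₀ M G hF n h (c v)) ^ 2 +
          ((avg u fun v => G n (c v)) - ∫ x, G n x ∂(predictor η₀ M (fun k => G k) n)) ^ 2) ∧
      ((∫ v, h (c v) ∂(mutationLaw MW G N n u)) -
          ∫ x, h x ∂(predictor η₀ M (fun k => G k) (n + 1))) ^ 2 ≤
        C * ((avg u fun v => pullback η₀ M G hF n h (c v)) ^ 2 +
          ((avg u fun v => G n (c v)) - ∫ x, G n x ∂(predictor η₀ M (fun k => G k) n)) ^ 2) := by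
  obtain ⟨C, hC, H⟩ := exists_ratio_bound η₀ M G hpos n
    (fellerMap (M (n + 1)) (hF (n + 1) (by omega)) h) (‖h‖ + ‖h‖)
  have hp := isProbabilityMeasure_predictor η₀ M G hG hpos (n + 1)
  refine ⟨C, hC, fun N u hN => H N (fun i => c (u i)) _ hN ?_ fun hp => ?_⟩
  · exact (abs_sub _ _).trans (add_le_add
      (abs_integral_le_of_abs_le fun v => abs_apply_le_norm h _)
      (abs_integral_le_of_abs_le (abs_apply_le_norm h)))
  · rw [integral_mutationLaw_of_pos M G hG hF MW hc hM n N h u hp,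
      integral_predictor_succ η₀ M G hG hpos]
    rfl

include hG hpos hF hc hM hη in
/-- The particle approximations converge at rate `1 / N` in mean square. -/
theorem exists_meanSquare_bound (n : ℕ) (h : ℝ →ᵇ ℝ) : ∃ C, 0 ≤ C ∧ ∀ N : ℕ, 0 < N →
    ∫ u, ((avg u fun v => h (c v)) - ∫ x, h x ∂(predictor η₀ M (fun k => G k) n)) ^ 2
      ∂(particleMarginal η₀W MW G N n) ≤ C / N := by
  have hcm := measurable_coordinate hc
  have hm : ∀ h : ℝ →ᵇ ℝ, Measurable fun v => h (c v) := fun h =>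
    h.continuous.measurable.comp hcm
  have hK : ∀ (h : ℝ →ᵇ ℝ) (v : ℝ × ℝ), |h (c v)| ≤ ‖h‖ := fun h v => abs_apply_le_norm h _
  induction n generalizing h with
  | zero =>
    refine ⟨‖h‖ ^ 2, by positivity, fun N hN => ?_⟩
    rw [predictor_zero, ← integral_marginal hcm hη]
    exact integral_sq_avg_pi_le η₀W (hm h) (hK h) hN
  | succ n ih =>
    obtain ⟨C, hC, H⟩ := exists_bias_bound η₀ M G hG hpos hF MW hc hM n h
    -- The conditional bias is controlled by the time-n errors of two functions, the pullback of `h`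
    -- and the potential; hence the induction is over all test functions at once.
    obtain ⟨C₁, hC₁, H₁⟩ := ih (pullback η₀ M G hF n h)
    obtain ⟨C₂, hC₂, H₂⟩ := ih (G n)
    rw [integral_pullback η₀ M G hG hpos] at H₁
    set m := ∫ x, h x ∂(predictor η₀ M (fun k => G k) (n + 1)) with hmdef
    refine ⟨2 * ‖h‖ ^ 2 + 2 * C * (C₁ + C₂), by positivity, fun N hN => ?_⟩
    have hN' : (0 : ℝ) < N := by exact_mod_cast hN
    set μ := particleMarginal η₀W MW G N n with hμ
    have i1 : Integrable (fun u => ((avg u fun v => pullback η₀ M G hF n h (c v)) - 0) ^ 2) μ :=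
      integrable_sq_avg_sub μ (hm _) (norm_nonneg _) (hK _) 0
    have i2 : Integrable (fun u => ((avg u fun v => G n (c v)) -
        ∫ x, G n x ∂(predictor η₀ M (fun k => G k) n)) ^ 2) μ :=
      integrable_sq_avg_sub μ (hm _) (norm_nonneg _) (hK _) _
    have hi : Integrable (fun v => ((avg v fun v => h (c v)) - m) ^ 2) (step MW G N n ∘ₘ μ) :=
      integrable_sq_avg_sub _ (hm h) (norm_nonneg _) (hK h) m
    rw [particleMarginal, integral_comp_measure hi]
    -- Given `u`, the error splits into the sampling fluctuation around the conditional mean `l`, of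
    -- variance at most ‖h‖²/N, and the bias l - m.
    have hpt : ∀ u : Fin N → ℝ × ℝ,
        ∫ v, ((avg v fun v => h (c v)) - m) ^ 2 ∂(step MW G N n u) ≤
          2 * (‖h‖ ^ 2 / N) + 2 * (C * (((avg u fun v => pullback η₀ M G hF n h (c v)) - 0) ^ 2 +
          ((avg u fun v => G n (c v)) -
            ∫ x, G n x ∂(predictor η₀ M (fun k => G k) n)) ^ 2)) := by
      intro u
      set l := ∫ v, h (c v) ∂(mutationLaw MW G N n u) with hl
      have j1 : Integrable (fun v => ((avg v fun v => h (c v)) - l) ^ 2) (step MW G N n u) :=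
        integrable_sq_avg_sub _ (hm h) (norm_nonneg _) (hK h) l
      have j2 : Integrable (fun v => ((avg v fun v => h (c v)) - m) ^ 2) (step MW G N n u) :=
        integrable_sq_avg_sub _ (hm h) (norm_nonneg _) (hK h) m
      calc ∫ v, ((avg v fun v => h (c v)) - m) ^ 2 ∂(step MW G N n u)
          ≤ ∫ v, (2 * ((avg v fun v => h (c v)) - l) ^ 2 + 2 * (l - m) ^ 2)
              ∂(step MW G N n u) := by
            refine integral_mono j2 ((j1.const_mul 2).add (integrable_const _)) fun v => ?_
            nlinarith [sq_nonneg ((avg v fun v => h (c v)) - l - (l - m))]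
        _ = 2 * (∫ v, ((avg v fun v => h (c v)) - l) ^ 2 ∂(step MW G N n u)) +
              2 * (l - m) ^ 2 := by
            rw [integral_add (j1.const_mul 2) (integrable_const _), integral_const_mul]
            simp
        _ ≤ _ := by
            rw [sub_zero]
            gcongr
            · rw [step_apply]
              exact integral_sq_avg_pi_le _ (hm h) (hK h) hN
            · exact (H N u hN).2
    have i12 : Integrable (fun u => ((avg u fun v => pullback η₀ M G hF n h (c v)) - 0) ^ 2 +
        ((avg u fun v => G n (c v)) -
          ∫ x, G n x ∂(predictor η₀ M (fun k => G k) n)) ^ 2) μ := i1.add i2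
    have i3 := (i12.const_mul C).const_mul 2
    have i4 : Integrable (fun u => ∫ v, ((avg v fun v => h (c v)) - m) ^ 2 ∂(step MW G N n u)) μ :=
      integrable_integral_comp_measure hi
    calc _ ≤ ∫ u, (2 * (‖h‖ ^ 2 / N) +
          2 * (C * (((avg u fun v => pullback η₀ M G hF n h (c v)) - 0) ^ 2 +
          ((avg u fun v => G n (c v)) -
            ∫ x, G n x ∂(predictor η₀ M (fun k => G k) n)) ^ 2))) ∂μ :=
          integral_mono i4 ((integrable_const _).add i3) hpt
      _ = 2 * (‖h‖ ^ 2 / N) + 2 * (C *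
          ((∫ u, ((avg u fun v => pullback η₀ M G hF n h (c v)) - 0) ^ 2 ∂μ) +
          ∫ u, ((avg u fun v => G n (c v)) -
            ∫ x, G n x ∂(predictor η₀ M (fun k => G k) n)) ^ 2 ∂μ)) := by
          rw [integral_add (integrable_const _) i3, integral_const_mul 2, integral_const_mul,
            integral_const_mul C, integral_add i1 i2]
          simp
      _ ≤ 2 * (‖h‖ ^ 2 / N) + 2 * (C * (C₁ / N + C₂ / N)) := by
          gcongr
          · exact H₁ N hN
          · exact H₂ N hN
      _ = _ := by field_simp

theorem abs_integral_weightedEmpirical_le {g : ℝ → ℝ} (hg : ∀ x, 0 ≤ g x) {N : ℕ}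
    (x : Fin N → ℝ) (k : ℝ →ᵇ ℝ) : |∫ y, k y ∂(weightedEmpirical g x)| ≤ ‖k‖ := by
  by_cases h : 0 < avg x g
  · have := isProbabilityMeasure_weightedEmpirical hg x h
    exact abs_integral_le_of_abs_le (abs_apply_le_norm k)
  -- With vanishing total weight, division by zero makes the weighted empirical measure zero, and
  -- its integrals vanish.
  · have h0 : avg x g = 0 := le_antisymm (not_lt.1 h)
      (mul_nonneg (by positivity) (Finset.sum_nonneg fun i _ => hg _))
    rw [integral_weightedEmpirical hg x k.continuous.measurable, h0]
    simp

include hG hpos hF hc hM hη in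
/-- The weighted empirical measures converge at rate `1 / N` in mean square. -/
theorem exists_meanSquare_weightedEmpirical_bound (n : ℕ) (k : ℝ →ᵇ ℝ) :
    ∃ C, 0 ≤ C ∧ ∀ N : ℕ, 0 < N →
      ∫ u, ((∫ y, k y ∂(weightedEmpirical (G n) fun i => c (u i))) -
        ∫ x, k x ∂(filterM η₀ M (fun k => G k) n)) ^ 2
        ∂(particleMarginal η₀W MW G N n) ≤ C / N := by
  have hcm := measurable_coordinate hc
  have hm : ∀ h : ℝ →ᵇ ℝ, Measurable fun v => h (c v) := fun h =>
    h.continuous.measurable.comp hcm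
  have hK : ∀ (h : ℝ →ᵇ ℝ) (v : ℝ × ℝ), |h (c v)| ≤ ‖h‖ := fun h v => abs_apply_le_norm h _
  have hf := isProbabilityMeasure_filterM η₀ M G hG hpos n
  obtain ⟨C, hC, H⟩ := exists_ratio_bound η₀ M G hpos n k (‖k‖ + ‖k‖)
  obtain ⟨C₁, hC₁, H₁⟩ := exists_meanSquare_bound η₀ M G hG hpos hF η₀W MW hc hη hM n
    (linearize η₀ M G n k)
  obtain ⟨C₂, hC₂, H₂⟩ := exists_meanSquare_bound η₀ M G hG hpos hF η₀W MW hc hη hM n (G n)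
  rw [integral_linearize η₀ M G hG hpos] at H₁
  refine ⟨C * (C₁ + C₂), by positivity, fun N hN => ?_⟩
  set μ := particleMarginal η₀W MW G N n with hμ
  have i1 : Integrable (fun u => ((avg u fun v => linearize η₀ M G n k (c v)) - 0) ^ 2) μ :=
    integrable_sq_avg_sub μ (hm _) (norm_nonneg _) (hK _) 0
  have i2 : Integrable (fun u => ((avg u fun v => G n (c v)) -
      ∫ x, G n x ∂(predictor η₀ M (fun k => G k) n)) ^ 2) μ :=
    integrable_sq_avg_sub μ (hm _) (norm_nonneg _) (hK _) _
  have i12 : Integrable (fun u => ((avg u fun v => linearize η₀ M G n k (c v)) - 0) ^ 2 +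
      ((avg u fun v => G n (c v)) -
        ∫ x, G n x ∂(predictor η₀ M (fun k => G k) n)) ^ 2) μ := i1.add i2
  have hb : ∀ u : Fin N → ℝ × ℝ, |(∫ y, k y ∂(weightedEmpirical (G n) fun i => c (u i))) -
      ∫ x, k x ∂(filterM η₀ M (fun k => G k) n)| ≤ ‖k‖ + ‖k‖ := fun u =>
    (abs_sub _ _).trans (add_le_add (abs_integral_weightedEmpirical_le (hG n) _ k)
      (abs_integral_le_of_abs_le (abs_apply_le_norm k)))
  calc _ ≤ ∫ u, C * (((avg u fun v => linearize η₀ M G n k (c v)) - 0) ^ 2 +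
        ((avg u fun v => G n (c v)) -
          ∫ x, G n x ∂(predictor η₀ M (fun k => G k) n)) ^ 2) ∂μ := by
        refine integral_mono_of_nonneg (ae_of_all _ fun u => sq_nonneg _) (i12.const_mul C)
          (ae_of_all _ fun u => ?_)
        simp only [sub_zero]
        refine (H N (fun i => c (u i)) _ hN (hb u) fun _ => ?_).2
        rw [integral_weightedEmpirical (hG n) _ k.continuous.measurable]
    _ = C * ((∫ u, ((avg u fun v => linearize η₀ M G n k (c v)) - 0) ^ 2 ∂μ) +
        ∫ u, ((avg u fun v => G n (c v)) -
          ∫ x, G n x ∂(predictor η₀ M (fun k => G k) n)) ^ 2 ∂μ) := by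
        rw [integral_const_mul, integral_add i1 i2]
    _ ≤ C * (C₁ / N + C₂ / N) := by
        gcongr
        · exact H₁ N hN
        · exact H₂ N hN
    _ = _ := by ring

end Coordinate

/-! ### Stability of the quantile coupling -/

/-- Continuous substitutes for indicators of half-lines: they trap distribution functions between
integrals to which weak convergence applies. -/
theorem exists_ramp {a b : ℝ} (hab : a < b) : ∃ h : ℝ →ᵇ ℝ, (∀ x, 0 ≤ h x) ∧ (∀ x, h x ≤ 1) ∧
    (∀ x, x ≤ a → h x = 1) ∧ ∀ x, b < x → h x = 0 := by
  have hd : 0 < b - a := sub_pos.2 hab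
  refine ⟨BoundedContinuousFunction.ofNormedAddCommGroup
    (fun x => max 0 (min 1 ((b - x) / (b - a)))) (by fun_prop) 1 fun x => ?_,
    fun x => le_max_left _ _, fun x => max_le zero_le_one (min_le_left _ _), fun x hx => ?_,
    fun x hx => ?_⟩
  · rw [Real.norm_of_nonneg (le_max_left _ _)]
    exact max_le zero_le_one (min_le_left _ _)
  · have : 1 ≤ (b - x) / (b - a) := by rw [le_div_iff₀ hd]; linarith
    simp [this]
  · have : (b - x) / (b - a) ≤ 0 := div_nonpos_of_nonpos_of_nonneg (by linarith) hd.le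
    simp [this]

theorem distFun_le_integral (ν : Measure ℝ) [IsFiniteMeasure ν] {h : ℝ →ᵇ ℝ} (h0 : ∀ x, 0 ≤ h x)
    {a : ℝ} (ha : ∀ x, x ≤ a → h x = 1) : distFun ν a ≤ ∫ x, h x ∂ν := by
  rw [distFun, ← integral_indicator_one measurableSet_Iic]
  refine integral_mono ((integrable_const (1 : ℝ)).indicator measurableSet_Iic)
    (integrable_bcf ν h) fun x => ?_
  by_cases hx : x ≤ a
  · simp [Set.indicator, hx, ha x hx]
  · simp [Set.indicator, hx, h0 x]

theorem integral_le_distFun (ν : Measure ℝ) [IsFiniteMeasure ν] {h : ℝ →ᵇ ℝ} (h1 : ∀ x, h x ≤ 1)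
    {b : ℝ} (hb : ∀ x, b < x → h x = 0) : ∫ x, h x ∂ν ≤ distFun ν b := by
  rw [distFun, ← integral_indicator_one measurableSet_Iic]
  refine integral_mono (integrable_bcf ν h)
    ((integrable_const (1 : ℝ)).indicator measurableSet_Iic) fun x => ?_
  by_cases hx : x ≤ b
  · simp [Set.indicator, hx, h1 x]
  · simp [Set.indicator, hx, hb x (not_le.1 hx)]

/-- The quantile at a continuity point is stable under weak perturbations of the measure. -/
theorem exists_quantile_stability (μ : Measure ℝ) [IsProbabilityMeasure μ]
    (hq : ContinuousOn (quantile μ) (Set.Ioo 0 1)) {w : ℝ} (hw : w ∈ Set.Ioo (0 : ℝ) 1) {δ : ℝ}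
    (hδ : 0 < δ) : ∃ (h₁ h₂ : ℝ →ᵇ ℝ) (ε : ℝ), 0 < ε ∧ ∀ ν : Measure ℝ, IsFiniteMeasure ν →
      |∫ x, h₁ x ∂ν - ∫ x, h₁ x ∂μ| < ε → |∫ x, h₂ x ∂ν - ∫ x, h₂ x ∂μ| < ε →
        |quantile ν w - quantile μ w| ≤ δ := by
  set q := quantile μ w with hqdef
  obtain ⟨h₁, h₁0, h₁1, h₁a, h₁b⟩ := exists_ramp (show q - δ < q - δ / 2 by linarith)
  obtain ⟨h₂, h₂0, h₂1, h₂a, h₂b⟩ := exists_ramp (show q + δ / 2 < q + δ by linarith)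
  -- The first ramp transfers this strict gap to `ν`: F_ν(q - δ) ≤ ν(h₁) ≈ μ(h₁) ≤ F_μ(q - δ/2) < w.
  have hlow : distFun μ (q - δ / 2) < w := by
    by_contra hcon
    have := (quantile_le_iff_le_distFun μ hw).2 (not_lt.1 hcon)
    linarith
  -- Here continuity of the quantile function is essential: it yields a strict margin F_μ(q + δ/2) ≥
  -- w' > w, ruling out a plateau of F_μ at level w to the right of q.
  obtain ⟨w', hw', hww', hqw'⟩ : ∃ w' ∈ Set.Ioo (0 : ℝ) 1, w < w' ∧ quantile μ w' ≤ q + δ / 2 := by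
    have hc : Tendsto (quantile μ) (𝓝 w) (𝓝 q) := hq.continuousAt (Ioo_mem_nhds hw.1 hw.2)
    have h1 : ∀ᶠ x in 𝓝[>] w, quantile μ x < q + δ / 2 :=
      (hc.mono_left nhdsWithin_le_nhds).eventually (gt_mem_nhds (by linarith))
    have h2 : ∀ᶠ x in 𝓝[>] w, x ∈ Set.Ioo (0 : ℝ) 1 :=
      nhdsWithin_le_nhds (Ioo_mem_nhds hw.1 hw.2)
    obtain ⟨x, hx1, hx2, hx3⟩ := (h1.and (h2.and self_mem_nhdsWithin)).exists
    exact ⟨x, hx2, hx3, hx1.le⟩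
  have hhigh : w' ≤ distFun μ (q + δ / 2) := (quantile_le_iff_le_distFun μ hw').1 hqw'
  refine ⟨h₁, h₂, min (w - distFun μ (q - δ / 2)) (w' - w),
    lt_min (sub_pos.2 hlow) (sub_pos.2 hww'), fun ν _ hν₁ hν₂ => ?_⟩
  have a1 := distFun_le_integral ν h₁0 h₁a
  have a2 := integral_le_distFun μ h₁1 h₁b
  have a3 := (abs_lt.1 (hν₁.trans_le (min_le_left _ _))).2
  have b1 := integral_le_distFun ν h₂1 h₂b
  have b2 := distFun_le_integral μ h₂0 h₂a
  have b3 := (abs_lt.1 (hν₂.trans_le (min_le_right _ _))).1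
  have hl : distFun ν (q - δ) < w := by linarith
  have hh : w ≤ distFun ν (q + δ) := by linarith
  -- `ν` may have mass less than one, so the level w must be shown to be reached.
  have hne : ∃ k : ℕ, w ≤ distFun ν k := by
    obtain ⟨k, hk⟩ := exists_nat_ge (q + δ)
    exact ⟨k, hh.trans (distFun_mono ν hk)⟩
  have c1 := (quantile_le_iff ν hw.1 hne).2 hh
  have c2 : q - δ < quantile ν w := by
    by_contra hcon
    exact absurd ((quantile_le_iff ν hw.1 hne).1 (not_lt.1 hcon)) (not_le.2 hl)
  rw [abs_le]
  constructor <;> linarith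

theorem tendsto_zero_of_forall_le {f : ℕ → ℝ} (h0 : ∀ N, 0 ≤ f N)
    (h : ∀ ε > 0, ∃ g : ℕ → ℝ, Tendsto g atTop (𝓝 0) ∧ ∀ N, f N ≤ ε + g N) :
    Tendsto f atTop (𝓝 0) := by
  refine tendsto_order.2 ⟨fun a ha => Eventually.of_forall fun N => ha.trans_le (h0 N),
    fun a ha => ?_⟩
  obtain ⟨g, hg, hfg⟩ := h (a / 2) (by linarith)
  filter_upwards [hg.eventually (gt_mem_nhds (show (0 : ℝ) < a / 2 by linarith))] with N hN
  linarith [hfg N]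

/-! ### Quantile couplings of random sub-probability measures -/

section RandomMeasures

variable {Ω : ℕ → Type*} [∀ N, MeasurableSpace (Ω N)] (P : (N : ℕ) → Measure (Ω N))
  [∀ N, IsProbabilityMeasure (P N)] (κ₁ κ₂ : (N : ℕ) → Kernel (Ω N) ℝ)
  (h₁ : ∀ N a, κ₁ N a Set.univ ≤ 1) (h₂ : ∀ N a, κ₂ N a Set.univ ≤ 1)
  (m₁ m₂ : Measure ℝ) [IsProbabilityMeasure m₁] [IsProbabilityMeasure m₂]

theorem isFiniteMeasure_of_univ_le_one {X : Type*} [MeasurableSpace X] {ν : Measure X}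
    (h : ν Set.univ ≤ 1) : IsFiniteMeasure ν := ⟨h.trans_lt ENNReal.one_lt_top⟩

theorem integrable_sq_integral_kernel_sub {α : Type*} [MeasurableSpace α] {l : Measure α}
    [IsFiniteMeasure l] {κ : Kernel α ℝ} (hκ : ∀ a, κ a Set.univ ≤ 1) (k : ℝ →ᵇ ℝ) (c : ℝ) :
    Integrable (fun a => ((∫ x, k x ∂(κ a)) - c) ^ 2) l := by
  have : IsFiniteKernel κ := ⟨⟨1, ENNReal.one_lt_top, hκ⟩⟩
  refine integrable_of_abs_le (((measurable_integral_kernel κ k.continuous.measurable).sub_const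
    c).pow_const 2) (K := (‖k‖ + |c|) ^ 2) fun a => ?_
  rw [abs_pow]
  gcongr
  refine (abs_sub _ _).trans ?_
  gcongr
  refine (norm_integral_le_of_norm_le_const (ae_of_all _ k.norm_coe_le_norm)).trans ?_
  refine mul_le_of_le_one_right (norm_nonneg _) ?_
  exact ENNReal.toReal_le_of_le_ofReal zero_le_one (by simpa using hκ a)

include h₁ h₂ in
theorem measurable_quantile_pair (N : ℕ) : Measurable fun z : Ω N × ℝ =>
    (quantile (κ₁ N z.1) z.2, quantile (κ₂ N z.1) z.2) := by
  have f₁ : ∀ N a, IsFiniteMeasure (κ₁ N a) := fun N a => isFiniteMeasure_of_univ_le_one (h₁ N a)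
  have f₂ : ∀ N a, IsFiniteMeasure (κ₂ N a) := fun N a => isFiniteMeasure_of_univ_le_one (h₂ N a)
  exact (measurable_quantile (κ₁ N).measurable).prodMk (measurable_quantile (κ₂ N).measurable)

variable (hk₁ : ∀ k : ℝ →ᵇ ℝ, Tendsto (fun N => ∫ a, ((∫ x, k x ∂(κ₁ N a)) - ∫ x, k x ∂m₁) ^ 2
    ∂(P N)) atTop (𝓝 0))
  (hk₂ : ∀ k : ℝ →ᵇ ℝ, Tendsto (fun N => ∫ a, ((∫ x, k x ∂(κ₂ N a)) - ∫ x, k x ∂m₂) ^ 2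
    ∂(P N)) atTop (𝓝 0))
  (hq₁ : ContinuousOn (quantile m₁) (Set.Ioo 0 1)) (hq₂ : ContinuousOn (quantile m₂) (Set.Ioo 0 1))

include h₁ h₂ hk₁ hk₂ hq₁ hq₂ in
-- At a fixed level, quantile stability needs only four test integrals to be close. When they are,
-- continuity of `H` makes the difference smaller than `e`; when they are not, a Chebyshev argument
-- pays for the trivial bound 2‖H‖ with the mean-square errors.
theorem tendsto_integral_abs_quantile_pair (H : ℝ × ℝ →ᵇ ℝ) {w : ℝ}
    (hw : w ∈ Set.Ioo (0 : ℝ) 1) :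
    Tendsto (fun N => ∫ a, |H (quantile (κ₁ N a) w, quantile (κ₂ N a) w) -
      H (quantile m₁ w, quantile m₂ w)| ∂(P N)) atTop (𝓝 0) := by
  refine tendsto_zero_of_forall_le (fun N => integral_nonneg fun a => abs_nonneg _) fun e he => ?_
  obtain ⟨δ, hδ, hH⟩ := Metric.continuousAt_iff.1
    (H.continuous.continuousAt (x := (quantile m₁ w, quantile m₂ w))) e he
  obtain ⟨f₁, f₂, ε₁, hε₁, hf⟩ := exists_quantile_stability m₁ hq₁ hw (half_pos hδ)
  obtain ⟨g₁, g₂, ε₂, hε₂, hg⟩ := exists_quantile_stability m₂ hq₂ hw (half_pos hδ)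
  -- Chosen so that C (min ε₁ ε₂)² = 2‖H‖: a single large test error already outweighs the trivial
  -- bound.
  set C := 2 * ‖H‖ / (min ε₁ ε₂) ^ 2 with hC
  have hε : 0 < min ε₁ ε₂ := lt_min hε₁ hε₂
  have hC0 : 0 ≤ C := by positivity
  refine ⟨fun N => C * ((∫ a, ((∫ x, f₁ x ∂(κ₁ N a)) - ∫ x, f₁ x ∂m₁) ^ 2 ∂(P N)) +
    (∫ a, ((∫ x, f₂ x ∂(κ₁ N a)) - ∫ x, f₂ x ∂m₁) ^ 2 ∂(P N)) +
    ((∫ a, ((∫ x, g₁ x ∂(κ₂ N a)) - ∫ x, g₁ x ∂m₂) ^ 2 ∂(P N)) +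
    (∫ a, ((∫ x, g₂ x ∂(κ₂ N a)) - ∫ x, g₂ x ∂m₂) ^ 2 ∂(P N)))), ?_, fun N => ?_⟩
  · have := (((hk₁ f₁).add (hk₁ f₂)).add ((hk₂ g₁).add (hk₂ g₂))).const_mul C
    simpa using this
  have i1 := integrable_sq_integral_kernel_sub (l := P N) (h₁ N) f₁ (∫ x, f₁ x ∂m₁)
  have i2 := integrable_sq_integral_kernel_sub (l := P N) (h₁ N) f₂ (∫ x, f₂ x ∂m₁)
  have i3 := integrable_sq_integral_kernel_sub (l := P N) (h₂ N) g₁ (∫ x, g₁ x ∂m₂)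
  have i4 := integrable_sq_integral_kernel_sub (l := P N) (h₂ N) g₂ (∫ x, g₂ x ∂m₂)
  have i12 : Integrable (fun a => ((∫ x, f₁ x ∂(κ₁ N a)) - ∫ x, f₁ x ∂m₁) ^ 2 +
    ((∫ x, f₂ x ∂(κ₁ N a)) - ∫ x, f₂ x ∂m₁) ^ 2) (P N) := i1.add i2
  have i34 : Integrable (fun a => ((∫ x, g₁ x ∂(κ₂ N a)) - ∫ x, g₁ x ∂m₂) ^ 2 +
    ((∫ x, g₂ x ∂(κ₂ N a)) - ∫ x, g₂ x ∂m₂) ^ 2) (P N) := i3.add i4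
  have i5 : Integrable (fun a => C * (((∫ x, f₁ x ∂(κ₁ N a)) - ∫ x, f₁ x ∂m₁) ^ 2 +
    ((∫ x, f₂ x ∂(κ₁ N a)) - ∫ x, f₂ x ∂m₁) ^ 2 +
    (((∫ x, g₁ x ∂(κ₂ N a)) - ∫ x, g₁ x ∂m₂) ^ 2 +
    ((∫ x, g₂ x ∂(κ₂ N a)) - ∫ x, g₂ x ∂m₂) ^ 2))) (P N) := (i12.add i34).const_mul C
  refine le_of_le_of_eq (integral_mono_of_nonneg (ae_of_all _ fun a => abs_nonneg _)
    ((integrable_const e).add i5) (ae_of_all _ fun a => ?_)) (by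
      simp only [Pi.add_apply]
      rw [integral_add (integrable_const e) i5, integral_const_mul, integral_add i12 i34,
        integral_add i1 i2, integral_add i3 i4]
      simp)
  simp only [Pi.add_apply]
  set z₁ := (∫ x, f₁ x ∂(κ₁ N a)) - ∫ x, f₁ x ∂m₁
  set z₂ := (∫ x, f₂ x ∂(κ₁ N a)) - ∫ x, f₂ x ∂m₁
  set z₃ := (∫ x, g₁ x ∂(κ₂ N a)) - ∫ x, g₁ x ∂m₂
  set z₄ := (∫ x, g₂ x ∂(κ₂ N a)) - ∫ x, g₂ x ∂m₂
  have hz0 : 0 ≤ C * (z₁ ^ 2 + z₂ ^ 2 + (z₃ ^ 2 + z₄ ^ 2)) := by positivity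
  by_cases hsmall : |z₁| < min ε₁ ε₂ ∧ |z₂| < min ε₁ ε₂ ∧ |z₃| < min ε₁ ε₂ ∧ |z₄| < min ε₁ ε₂
  · obtain ⟨s1, s2, s3, s4⟩ := hsmall
    have d1 := hf (κ₁ N a) (isFiniteMeasure_of_univ_le_one (h₁ N a))
      (s1.trans_le (min_le_left _ _)) (s2.trans_le (min_le_left _ _))
    have d2 := hg (κ₂ N a) (isFiniteMeasure_of_univ_le_one (h₂ N a))
      (s3.trans_le (min_le_right _ _)) (s4.trans_le (min_le_right _ _))
    have d3 := hH (x := (quantile (κ₁ N a) w, quantile (κ₂ N a) w)) (by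
      rw [Prod.dist_eq, Real.dist_eq, Real.dist_eq]
      exact max_lt (by linarith) (by linarith))
    rw [Real.dist_eq] at d3
    linarith
  · have hbig : (min ε₁ ε₂) ^ 2 ≤ z₁ ^ 2 + z₂ ^ 2 + (z₃ ^ 2 + z₄ ^ 2) := by
      by_contra hcon
      rw [not_le] at hcon
      refine hsmall ⟨?_, ?_, ?_, ?_⟩ <;> refine abs_lt_of_sq_lt_sq ?_ hε.le <;>
        nlinarith [sq_nonneg z₁, sq_nonneg z₂, sq_nonneg z₃, sq_nonneg z₄]
    have hH2 : |H (quantile (κ₁ N a) w, quantile (κ₂ N a) w) -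
        H (quantile m₁ w, quantile m₂ w)| ≤ 2 * ‖H‖ := by
      refine (abs_sub _ _).trans ?_
      linarith [abs_apply_le_norm H (quantile (κ₁ N a) w, quantile (κ₂ N a) w),
        abs_apply_le_norm H (quantile m₁ w, quantile m₂ w)]
    have hC2 : 2 * ‖H‖ = C * (min ε₁ ε₂) ^ 2 := by rw [hC]; field_simp
    have := mul_le_mul_of_nonneg_left hbig hC0
    linarith

include h₁ h₂ hk₁ hk₂ hq₁ hq₂ in
/-- If random measures converge weakly in probability to measures with continuous quantiles, then
so do their quantile couplings. -/
theorem tendsto_integral_abs_quantileCoupling (H : ℝ × ℝ →ᵇ ℝ) :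
    Tendsto (fun N => ∫ a, |(∫ z, H z ∂(quantileCoupling (κ₁ N a) (κ₂ N a))) -
      ∫ z, H z ∂(quantileCoupling m₁ m₂)| ∂(P N)) atTop (𝓝 0) := by
  set V := volume.restrict (Set.Ioo (0 : ℝ) 1) with hV
  have hm₁₂ : Measurable fun w => (quantile m₁ w, quantile m₂ w) :=
    (measurable_quantile_fixed m₁).prodMk (measurable_quantile_fixed m₂)
  have hHm : Measurable H := H.continuous.measurable
  have hmeas : ∀ N, Measurable fun z : Ω N × ℝ =>
      |H (quantile (κ₁ N z.1) z.2, quantile (κ₂ N z.1) z.2) -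
        H (quantile m₁ z.2, quantile m₂ z.2)| := fun N =>
    ((hHm.comp (measurable_quantile_pair κ₁ κ₂ h₁ h₂ N)).sub
      (hHm.comp (hm₁₂.comp measurable_snd))).abs
  have hbd : ∀ x y : ℝ × ℝ, |(|H x - H y|)| ≤ 2 * ‖H‖ := fun x y => by
    rw [abs_abs]
    refine (abs_sub _ _).trans ?_
    linarith [abs_apply_le_norm H x, abs_apply_le_norm H y]
  -- Dominated convergence over the level w lifts the fixed-level statement; Fubini below exchanges
  -- the level with the randomness.
  have hint : Tendsto (fun N => ∫ w, ∫ a, |H (quantile (κ₁ N a) w, quantile (κ₂ N a) w) -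
      H (quantile m₁ w, quantile m₂ w)| ∂(P N) ∂V) atTop (𝓝 0) := by
    have h := tendsto_integral_of_dominated_convergence (μ := V)
      (F := fun N w => ∫ a, |H (quantile (κ₁ N a) w, quantile (κ₂ N a) w) -
        H (quantile m₁ w, quantile m₂ w)| ∂(P N)) (f := fun _ => 0) (fun _ => 2 * ‖H‖)
      (fun N => (hmeas N).stronglyMeasurable.integral_prod_left.aestronglyMeasurable)
      (integrable_const _)
      (fun N => ae_of_all _ fun w => abs_integral_le_of_abs_le fun a => hbd _ _)
      ((ae_restrict_mem measurableSet_Ioo).mono fun w hw =>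
        tendsto_integral_abs_quantile_pair P κ₁ κ₂ h₁ h₂ m₁ m₂ hk₁ hk₂ hq₁ hq₂ H hw)
    simpa using h
  refine squeeze_zero (fun N => integral_nonneg fun a => abs_nonneg _) (fun N => ?_) hint
  have hprod : Integrable (fun z : Ω N × ℝ =>
      |H (quantile (κ₁ N z.1) z.2, quantile (κ₂ N z.1) z.2) -
        H (quantile m₁ z.2, quantile m₂ z.2)|) ((P N).prod V) :=
    integrable_of_abs_le (hmeas N) fun z => hbd _ _
  rw [← integral_integral_swap (f := fun a w => |H (quantile (κ₁ N a) w, quantile (κ₂ N a) w) -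
    H (quantile m₁ w, quantile m₂ w)|) hprod]
  refine integral_mono_of_nonneg (ae_of_all _ fun a => abs_nonneg _) hprod.integral_prod_left
    (ae_of_all _ fun a => ?_)
  have hqa : Measurable fun w => (quantile (κ₁ N a) w, quantile (κ₂ N a) w) :=
    (measurable_quantile_pair κ₁ κ₂ h₁ h₂ N).comp measurable_prodMk_left
  simp only [quantileCoupling]
  rw [integral_map hqa.aemeasurable hHm.aestronglyMeasurable,
    integral_map hm₁₂.aemeasurable hHm.aestronglyMeasurable, ← integral_sub]
  · exact abs_integral_le_integral_abs
  · exact integrable_of_abs_le (hHm.comp hqa) fun w => abs_apply_le_norm H _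
  · exact integrable_of_abs_le (hHm.comp hm₁₂) fun w => abs_apply_le_norm H _

end RandomMeasures

/-! ### The central limit theorem -/

theorem tendsto_zero_of_le_div {f : ℕ → ℝ} (h0 : ∀ N, 0 ≤ f N) {C : ℝ}
    (h : ∀ N : ℕ, 0 < N → f N ≤ C / N) : Tendsto f atTop (𝓝 0) :=
  squeeze_zero' (Eventually.of_forall h0) ((eventually_gt_atTop 0).mono h)
    (tendsto_const_div_atTop_nhds_zero_nat C)

theorem weightedEmpirical_univ_le_one {g : ℝ → ℝ} (hg : ∀ x, 0 ≤ g x) {N : ℕ} (x : Fin N → ℝ) :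
    weightedEmpirical g x Set.univ ≤ 1 := by
  have h := abs_integral_weightedEmpirical_le hg x (BoundedContinuousFunction.const ℝ 1)
  have h1 : ‖BoundedContinuousFunction.const ℝ (1 : ℝ)‖ ≤ 1 :=
    (BoundedContinuousFunction.norm_const_le _).trans (by simp)
  simp only [BoundedContinuousFunction.const_apply, integral_const, smul_eq_mul, mul_one,
    measureReal_def, abs_of_nonneg ENNReal.toReal_nonneg] at h
  rw [← ENNReal.ofReal_toReal (measure_ne_top (weightedEmpirical g x) Set.univ)]
  exact ENNReal.ofReal_le_one.2 (h.trans h1)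

/-- The weighted empirical measure of one coordinate of the particles, as a kernel. -/
def weightedKernel {g : ℝ → ℝ} (hg : Measurable g) {c : ℝ × ℝ → ℝ} (hc : Measurable c) (N : ℕ) :
    Kernel (Fin N → ℝ × ℝ) ℝ where
  toFun u := weightedEmpirical g fun i => c (u i)
  measurable' := (measurable_weightedEmpirical hg N).comp
    (f := fun u : Fin N → ℝ × ℝ => fun i => c (u i)) (by fun_prop)

/-- The function `φ ⊗ 1 - 1 ⊗ ψ`. -/
def pairDiff (φ ψ : ℝ →ᵇ ℝ) : ℝ × ℝ →ᵇ ℝ :=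
  φ.compContinuous ⟨Prod.fst, continuous_fst⟩ - ψ.compContinuous ⟨Prod.snd, continuous_snd⟩

theorem pairDiff_apply (φ ψ : ℝ →ᵇ ℝ) (u : ℝ × ℝ) : pairDiff φ ψ u = φ u.1 - ψ u.2 := rfl

theorem integral_pairDiff (φ ψ : ℝ →ᵇ ℝ) (l : Measure (ℝ × ℝ)) [IsProbabilityMeasure l] :
    ∫ u, pairDiff φ ψ u ∂l = (∫ u, φ u.1 ∂l) - ∫ u, ψ u.2 ∂l := by
  simp_rw [pairDiff_apply]
  refine integral_sub ?_ ?_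
  · exact integrable_of_abs_le (φ.continuous.measurable.comp measurable_fst)
      fun u => abs_apply_le_norm φ _
  · exact integrable_of_abs_le (ψ.continuous.measurable.comp measurable_snd)
      fun u => abs_apply_le_norm ψ _

theorem abs_exp_sub_exp_le {x y : ℝ} (hx : x ≤ 0) (hy : y ≤ 0) :
    |Real.exp x - Real.exp y| ≤ |x - y| := by
  wlog h : y ≤ x generalizing x y
  · rw [abs_sub_comm, abs_sub_comm x]
    exact this hy hx (le_of_not_ge h)
  rw [abs_of_nonneg (sub_nonneg.2 (Real.exp_le_exp.2 h)), abs_of_nonneg (sub_nonneg.2 h)]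
  have h1 : Real.exp y = Real.exp x * Real.exp (y - x) := by rw [← Real.exp_add]; ring_nf
  have h2 := Real.add_one_le_exp (y - x)
  have h3 : Real.exp x ≤ 1 := Real.exp_le_one_iff.2 hx
  have h4 := Real.exp_pos x
  rw [h1]
  nlinarith

theorem norm_exp_mul_I_sub_le (x y : ℝ) :
    ‖Complex.exp (x * Complex.I) - Complex.exp (y * Complex.I)‖ ≤ |x - y| := by
  have e : Complex.exp (x * Complex.I) - Complex.exp (y * Complex.I) =
      Complex.exp (y * Complex.I) * (Complex.exp (Complex.I * (x - y : ℝ)) - 1) := by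
    rw [mul_sub, mul_one, ← Complex.exp_add]
    congr 2
    push_cast
    ring
  rw [e, norm_mul, Complex.norm_exp_ofReal_mul_I, one_mul]
  exact Real.norm_exp_I_mul_ofReal_sub_one_le

theorem integral_sq_sub_mean {X : Type*} [TopologicalSpace X] [MeasurableSpace X]
    [OpensMeasurableSpace X] (l : Measure X) [IsProbabilityMeasure l] (F : X →ᵇ ℝ) :
    ∫ x, (F x - ∫ y, F y ∂l) ^ 2 ∂l = (∫ x, (F * F) x ∂l) - (∫ x, F x ∂l) ^ 2 := by
  have i1 := integrable_bcf l (F * F)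
  have i2 : Integrable (fun x => 2 * (∫ y, F y ∂l) * F x) l := (integrable_bcf l F).const_mul _
  have e : ∀ x, (F x - ∫ y, F y ∂l) ^ 2 =
      (F * F) x - 2 * (∫ y, F y ∂l) * F x + (∫ y, F y ∂l) ^ 2 := fun x => by
    rw [BoundedContinuousFunction.mul_apply]; ring
  have i3 : Integrable (fun x => (F * F) x - 2 * (∫ y, F y ∂l) * F x) l := i1.sub i2
  simp_rw [e]
  rw [integral_add i3 (integrable_const _), integral_sub i1 i2, integral_const_mul]
  simp
  ring

/-- Convergence of variances reduces to convergence of the integrals of F and F², both of which are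
bounded and continuous. -/
theorem abs_integral_sq_sub_mean_sub_le {X : Type*} [TopologicalSpace X] [MeasurableSpace X]
    [OpensMeasurableSpace X] (l m : Measure X) [IsProbabilityMeasure l] [IsProbabilityMeasure m]
    (F : X →ᵇ ℝ) :
    |∫ x, (F x - ∫ y, F y ∂l) ^ 2 ∂l - ∫ x, (F x - ∫ y, F y ∂m) ^ 2 ∂m| ≤
      |∫ x, (F * F) x ∂l - ∫ x, (F * F) x ∂m| + 2 * ‖F‖ * |∫ x, F x ∂l - ∫ x, F x ∂m| := by
  rw [integral_sq_sub_mean, integral_sq_sub_mean]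
  set a := ∫ x, F x ∂l
  set b := ∫ x, F x ∂m
  have ha : |a| ≤ ‖F‖ := abs_integral_le_of_abs_le (abs_apply_le_norm F)
  have hb : |b| ≤ ‖F‖ := abs_integral_le_of_abs_le (abs_apply_le_norm F)
  have e : (∫ x, (F * F) x ∂l) - a ^ 2 - ((∫ x, (F * F) x ∂m) - b ^ 2) =
      ((∫ x, (F * F) x ∂l) - ∫ x, (F * F) x ∂m) - (a + b) * (a - b) := by ring
  rw [e]
  refine (abs_sub _ _).trans ?_
  rw [abs_mul]
  gcongr
  exact (abs_add_le _ _).trans (by linarith)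

theorem norm_charFun_avg_sub_exp_le {X : Type*} [TopologicalSpace X] [MeasurableSpace X]
    [OpensMeasurableSpace X] (l : Measure X) [IsProbabilityMeasure l] (F : X →ᵇ ℝ) {N : ℕ}
    (hN : 0 < N) {t : ℝ} (ht : |t| * (2 * ‖F‖) ≤ √N) :
    ‖(∫ v, Complex.exp ((t * √N * (avg v F - ∫ x, F x ∂l) : ℝ) * Complex.I)
        ∂(Measure.pi fun _ : Fin N => l)) -
        Complex.exp (-(t ^ 2 * ∫ x, (F x - ∫ y, F y ∂l) ^ 2 ∂l) / 2 : ℝ)‖ ≤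
      ((|t| * (2 * ‖F‖)) ^ 3 + (|t| * (2 * ‖F‖)) ^ 4) / √N := by
  set m := ∫ x, F x ∂l with hm
  have hb : ∀ x, |F x - m| ≤ 2 * ‖F‖ := fun x => by
    refine (abs_sub _ _).trans ?_
    linarith [abs_apply_le_norm F x, abs_integral_le_of_abs_le (l := l) (abs_apply_le_norm F)]
  have h0 : ∫ x, (F x - m) ∂l = 0 := by
    rw [integral_sub (integrable_bcf l F) (integrable_const _)]
    simp [hm]
  have h := norm_charFun_pow_sub_exp_le (l := l) (f := fun x => F x - m)
    (F.continuous.measurable.sub_const m) hb h0 hN ht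
  rw [← integral_exp_avg_pi] at h
  simp_rw [avg_sub _ F (fun _ => m), avg_const hN] at h
  exact h

section Coordinate

set_option linter.unusedSectionVars false

variable (η₀ : Measure ℝ) [IsProbabilityMeasure η₀] (M : ℕ → Kernel ℝ ℝ)
  [∀ n, IsMarkovKernel (M n)] (G : ℕ → ℝ →ᵇ ℝ) (hG : ∀ n x, 0 ≤ G n x)
  (hpos : ∀ n, 0 < ∫ x, G n x ∂(predictor η₀ M (fun k => G k) n))
  (hF : ∀ n, 1 ≤ n → IsFeller (M n)) (η₀W : Measure (ℝ × ℝ)) [IsProbabilityMeasure η₀W]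
  (MW : ℕ → Kernel (ℝ × ℝ) (ℝ × ℝ)) [∀ n, IsMarkovKernel (MW n)] {c : ℝ × ℝ → ℝ}
  (hc : c = Prod.fst ∨ c = Prod.snd) (hη : η₀W.map c = η₀)
  (hM : ∀ n, 1 ≤ n → ∀ u : ℝ × ℝ, (MW n u).map c = M n (c u))

include hG hpos hF hc hM hη in
/-- The error in the linearisation of the conditional bias is of order `1 / N`. -/
theorem exists_linearisation_error_bound (n : ℕ) (h : ℝ →ᵇ ℝ) : ∃ C, 0 ≤ C ∧ ∀ N : ℕ, 0 < N →
    Integrable (fun u => |(∫ v, h (c v) ∂(mutationLaw MW G N n u)) -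
      (∫ x, h x ∂(predictor η₀ M (fun k => G k) (n + 1))) -
      avg u (fun v => pullback η₀ M G hF n h (c v))|) (particleMarginal η₀W MW G N n) ∧
    ∫ u, |(∫ v, h (c v) ∂(mutationLaw MW G N n u)) -
      (∫ x, h x ∂(predictor η₀ M (fun k => G k) (n + 1))) -
      avg u (fun v => pullback η₀ M G hF n h (c v))| ∂(particleMarginal η₀W MW G N n) ≤ C / N := by
  have hcm := measurable_coordinate hc
  have hm : ∀ h : ℝ →ᵇ ℝ, Measurable fun v => h (c v) := fun h =>
    h.continuous.measurable.comp hcm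
  have hK : ∀ (h : ℝ →ᵇ ℝ) (v : ℝ × ℝ), |h (c v)| ≤ ‖h‖ := fun h v => abs_apply_le_norm h _
  obtain ⟨C, hC, H⟩ := exists_bias_bound η₀ M G hG hpos hF MW hc hM n h
  obtain ⟨C₁, hC₁, H₁⟩ := exists_meanSquare_bound η₀ M G hG hpos hF η₀W MW hc hη hM n
    (pullback η₀ M G hF n h)
  obtain ⟨C₂, hC₂, H₂⟩ := exists_meanSquare_bound η₀ M G hG hpos hF η₀W MW hc hη hM n (G n)
  rw [integral_pullback η₀ M G hG hpos] at H₁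
  refine ⟨C * (C₁ + C₂), by positivity, fun N hN => ?_⟩
  set μ := particleMarginal η₀W MW G N n with hμ
  have i1 : Integrable (fun u => ((avg u fun v => pullback η₀ M G hF n h (c v)) - 0) ^ 2) μ :=
    integrable_sq_avg_sub μ (hm _) (norm_nonneg _) (hK _) 0
  have i2 : Integrable (fun u => ((avg u fun v => G n (c v)) -
      ∫ x, G n x ∂(predictor η₀ M (fun k => G k) n)) ^ 2) μ :=
    integrable_sq_avg_sub μ (hm _) (norm_nonneg _) (hK _) _
  have i12 : Integrable (fun u => C * (((avg u fun v => pullback η₀ M G hF n h (c v)) - 0) ^ 2 +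
      ((avg u fun v => G n (c v)) -
        ∫ x, G n x ∂(predictor η₀ M (fun k => G k) n)) ^ 2)) μ := (i1.add i2).const_mul C
  have hpt : ∀ u : Fin N → ℝ × ℝ, |(∫ v, h (c v) ∂(mutationLaw MW G N n u)) -
      (∫ x, h x ∂(predictor η₀ M (fun k => G k) (n + 1))) -
      avg u (fun v => pullback η₀ M G hF n h (c v))| ≤
      C * (((avg u fun v => pullback η₀ M G hF n h (c v)) - 0) ^ 2 +
      ((avg u fun v => G n (c v)) -
        ∫ x, G n x ∂(predictor η₀ M (fun k => G k) n)) ^ 2) := fun u => by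
    rw [sub_zero]; exact (H N u hN).1
  have hmeas : Measurable fun u : Fin N → ℝ × ℝ => |(∫ v, h (c v) ∂(mutationLaw MW G N n u)) -
      (∫ x, h x ∂(predictor η₀ M (fun k => G k) (n + 1))) -
      avg u (fun v => pullback η₀ M G hF n h (c v))| :=
    (((measurable_integral_kernel _ (hm h)).sub_const _).sub (measurable_avg (hm _))).abs
  have hint : Integrable (fun u => |(∫ v, h (c v) ∂(mutationLaw MW G N n u)) -
      (∫ x, h x ∂(predictor η₀ M (fun k => G k) (n + 1))) -
      avg u (fun v => pullback η₀ M G hF n h (c v))|) μ :=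
    i12.mono' hmeas.aestronglyMeasurable (ae_of_all _ fun u => by
      rw [Real.norm_eq_abs, abs_abs]; exact hpt u)
  refine ⟨hint, (integral_mono hint i12 hpt).trans ?_⟩
  rw [integral_const_mul, integral_add i1 i2, mul_add, mul_add, add_div, mul_div_assoc,
    mul_div_assoc]
  gcongr
  · exact H₁ N hN
  · exact H₂ N hN

end Coordinate

/-! ### Recursion in time for the couplings, the variance and the characteristic functions -/

section Main

set_option linter.unusedSectionVars false

variable (η₀f η₀c : Measure ℝ) (η₀W : Measure (ℝ × ℝ))
  [IsProbabilityMeasure η₀f] [IsProbabilityMeasure η₀c] [IsProbabilityMeasure η₀W]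
  (hη₀f : η₀W.map Prod.fst = η₀f) (hη₀c : η₀W.map Prod.snd = η₀c)
  (Mf Mc : ℕ → Kernel ℝ ℝ) (MW : ℕ → Kernel (ℝ × ℝ) (ℝ × ℝ))
  [∀ n, IsMarkovKernel (Mf n)] [∀ n, IsMarkovKernel (Mc n)] [∀ n, IsMarkovKernel (MW n)]
  (hMf : ∀ n, 1 ≤ n → ∀ u : ℝ × ℝ, (MW n u).map Prod.fst = Mf n u.1)
  (hMc : ∀ n, 1 ≤ n → ∀ u : ℝ × ℝ, (MW n u).map Prod.snd = Mc n u.2)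
  (G : ℕ → ℝ →ᵇ ℝ) (hG : ∀ n x, 0 ≤ G n x)
  (hGf : ∀ n, 0 < ∫ x, G n x ∂(predictor η₀f Mf (fun k => G k) n))
  (hGc : ∀ n, 0 < ∫ x, G n x ∂(predictor η₀c Mc (fun k => G k) n))
  (hQf : ∀ n, ContinuousOn (quantile (filterM η₀f Mf (fun k => G k) n)) (Set.Ioo 0 1))
  (hQc : ∀ n, ContinuousOn (quantile (filterM η₀c Mc (fun k => G k) n)) (Set.Ioo 0 1))
  (hFelf : ∀ n, 1 ≤ n → IsFeller (Mf n)) (hFelc : ∀ n, 1 ≤ n → IsFeller (Mc n))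
  (hFelW : ∀ n, 1 ≤ n → IsFeller (MW n))

include hη₀f hη₀c hMf hMc hG hGf hGc in
-- A case distinction suffices, without induction: each new coupling is built from the two filters
-- and not from the preceding coupling.
theorem limitCoupling_marginals (n : ℕ) :
    IsProbabilityMeasure (limitCoupling η₀f η₀c η₀W Mf Mc MW (fun k => G k) n) ∧
    (limitCoupling η₀f η₀c η₀W Mf Mc MW (fun k => G k) n).map Prod.fst =
      predictor η₀f Mf (fun k => G k) n ∧
    (limitCoupling η₀f η₀c η₀W Mf Mc MW (fun k => G k) n).map Prod.snd =
      predictor η₀c Mc (fun k => G k) n := by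
  cases n with
  | zero =>
    rw [predictor_zero, predictor_zero]
    exact ⟨‹_›, hη₀f, hη₀c⟩
  | succ n =>
    have hf := isProbabilityMeasure_filterM η₀f Mf G hG hGf n
    have hc := isProbabilityMeasure_filterM η₀c Mc G hG hGc n
    have hq := isProbabilityMeasure_quantileCoupling (filterM η₀f Mf (fun k => G k) n)
      (filterM η₀c Mc (fun k => G k) n)
    rw [limitCoupling]
    refine ⟨inferInstance, ?_, ?_⟩
    · rw [map_comp_eq_of_marginal measurable_fst (hMf (n + 1) (by omega)),
        map_fst_quantileCoupling, map_quantile, predictor_succ η₀f Mf G hG hGf]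
    · rw [map_comp_eq_of_marginal measurable_snd (hMc (n + 1) (by omega)),
        map_snd_quantileCoupling, map_quantile, predictor_succ η₀c Mc G hG hGc]

include hη₀f hη₀c hMf hMc hG hGf hGc in
theorem integral_pairDiff_limitCoupling (n : ℕ) (φ ψ : ℝ →ᵇ ℝ) :
    ∫ u, pairDiff φ ψ u ∂(limitCoupling η₀f η₀c η₀W Mf Mc MW (fun k => G k) n) =
      (∫ x, φ x ∂(predictor η₀f Mf (fun k => G k) n)) -
        ∫ x, ψ x ∂(predictor η₀c Mc (fun k => G k) n) := by
  obtain ⟨hp, h1, h2⟩ := limitCoupling_marginals η₀f η₀c η₀W hη₀f hη₀c Mf Mc MW hMf hMc G hG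
    hGf hGc n
  rw [integral_pairDiff, integral_marginal measurable_fst h1, integral_marginal measurable_snd h2]

include hη₀f hη₀c hMf hMc hG hGf hGc in
theorem integral_sq_operatorD_self (n : ℕ) (φ ψ : ℝ →ᵇ ℝ) :
    ∫ u, (operatorD η₀f Mf (fun k => G k) n n φ u.1 - operatorD η₀c Mc (fun k => G k) n n ψ u.2) ^ 2
      ∂(limitCoupling η₀f η₀c η₀W Mf Mc MW (fun k => G k) n) =
    ∫ u, (pairDiff φ ψ u -
        ∫ v, pairDiff φ ψ v ∂(limitCoupling η₀f η₀c η₀W Mf Mc MW (fun k => G k) n)) ^ 2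
      ∂(limitCoupling η₀f η₀c η₀W Mf Mc MW (fun k => G k) n) := by
  rw [integral_pairDiff_limitCoupling η₀f η₀c η₀W hη₀f hη₀c Mf Mc MW hMf hMc G hG hGf hGc]
  congr 1 with u
  rw [operatorD_self _ _ _ _ _ _ (isProbabilityMeasure_predictor η₀f Mf G hG hGf n),
    operatorD_self _ _ _ _ _ _ (isProbabilityMeasure_predictor η₀c Mc G hG hGc n), pairDiff_apply]
  ring

include hη₀f hη₀c hMf hMc hG hGf hGc in
theorem asympVar_zero (φ ψ : ℝ →ᵇ ℝ) :
    asympVar η₀f η₀c η₀W Mf Mc MW (fun k => G k) 0 φ ψ =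
      ∫ u, (pairDiff φ ψ u - ∫ v, pairDiff φ ψ v ∂η₀W) ^ 2 ∂η₀W := by
  rw [asympVar, Finset.sum_range_one,
    integral_sq_operatorD_self η₀f η₀c η₀W hη₀f hη₀c Mf Mc MW hMf hMc G hG hGf hGc]
  rfl

include hη₀f hη₀c hMf hMc hG hGf hGc in
-- The terms p ≤ n form the time-n variance of the pulled-back pair, by `operatorD_succ`; the term p
-- = n + 1 is the variance of F under the new coupling, contributed by the last sampling step.
theorem asympVar_succ (n : ℕ) (φ ψ : ℝ →ᵇ ℝ) :
    asympVar η₀f η₀c η₀W Mf Mc MW (fun k => G k) (n + 1) φ ψ =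
      asympVar η₀f η₀c η₀W Mf Mc MW (fun k => G k) n
        (pullback η₀f Mf G hFelf n φ) (pullback η₀c Mc G hFelc n ψ) +
      ∫ u, (pairDiff φ ψ u -
        ∫ v, pairDiff φ ψ v ∂(limitCoupling η₀f η₀c η₀W Mf Mc MW (fun k => G k) (n + 1))) ^ 2
      ∂(limitCoupling η₀f η₀c η₀W Mf Mc MW (fun k => G k) (n + 1)) := by
  rw [asympVar, Finset.sum_range_succ,
    integral_sq_operatorD_self η₀f η₀c η₀W hη₀f hη₀c Mf Mc MW hMf hMc G hG hGf hGc, asympVar]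
  congr 1
  refine Finset.sum_congr rfl fun p hp => ?_
  have hpn : p ≤ n := by simpa [Nat.lt_succ_iff] using hp
  rw [operatorD_succ η₀f Mf G hG hGf hFelf hpn, operatorD_succ η₀c Mc G hG hGc hFelc hpn]

include hη₀f hη₀c hMf hMc hG hGf hGc hQf hQc hFelf hFelc hFelW in
/-- The conditional law of a pair at time `n + 1` converges to the limiting coupling. -/
theorem tendsto_integral_abs_mutationLaw (n : ℕ) (H : ℝ × ℝ →ᵇ ℝ) :
    Tendsto (fun N => ∫ u, |(∫ v, H v ∂(mutationLaw MW G N n u)) -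
      ∫ v, H v ∂(limitCoupling η₀f η₀c η₀W Mf Mc MW (fun k => G k) (n + 1))|
        ∂(particleMarginal η₀W MW G N n)) atTop (𝓝 0) := by
  have hf := isProbabilityMeasure_filterM η₀f Mf G hG hGf n
  have hc := isProbabilityMeasure_filterM η₀c Mc G hG hGc n
  have hq := isProbabilityMeasure_quantileCoupling (filterM η₀f Mf (fun k => G k) n)
    (filterM η₀c Mc (fun k => G k) n)
  have hgm := (G n).continuous.measurable
  -- The Feller property of the coupled kernel makes M̌_{n+1}(H) an admissible test function for the
  -- convergence of the resampling couplings.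
  have h := tendsto_integral_abs_quantileCoupling (fun N => particleMarginal η₀W MW G N n)
    (fun N => weightedKernel hgm measurable_fst N) (fun N => weightedKernel hgm measurable_snd N)
    (fun N u => weightedEmpirical_univ_le_one (hG n) _)
    (fun N u => weightedEmpirical_univ_le_one (hG n) _)
    (filterM η₀f Mf (fun k => G k) n) (filterM η₀c Mc (fun k => G k) n)
    (fun k => by
      obtain ⟨C, -, h⟩ := exists_meanSquare_weightedEmpirical_bound η₀f Mf G hG hGf hFelf η₀W MW
        (Or.inl rfl) hη₀f hMf n k
      exact tendsto_zero_of_le_div (fun N => integral_nonneg fun u => sq_nonneg _) h)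
    (fun k => by
      obtain ⟨C, -, h⟩ := exists_meanSquare_weightedEmpirical_bound η₀c Mc G hG hGc hFelc η₀W MW
        (Or.inr rfl) hη₀c hMc n k
      exact tendsto_zero_of_le_div (fun N => integral_nonneg fun u => sq_nonneg _) h)
    (hQf n) (hQc n) (fellerMap (MW (n + 1)) (hFelW (n + 1) (by omega)) H)
  refine h.congr fun N => ?_
  congr 1 with u
  rw [limitCoupling, integral_comp_measure (integrable_bcf _ H), mutationLaw_apply,
    integral_comp_measure (integrable_bcf _ H)]
  rfl

include hη₀f hη₀c hMf hMc hG hGf hGc hQf hQc hFelf hFelc hFelW in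
/-- Convergence of the characteristic functions of the normalised errors. -/
theorem tendsto_charFun_particleMarginal (n : ℕ) (φ ψ : ℝ →ᵇ ℝ) (t : ℝ) :
    Tendsto (fun N : ℕ => ∫ u, Complex.exp ((t * √N * (avg u (pairDiff φ ψ) -
        ∫ v, pairDiff φ ψ v ∂(limitCoupling η₀f η₀c η₀W Mf Mc MW (fun k => G k) n)) : ℝ) *
          Complex.I) ∂(particleMarginal η₀W MW G N n)) atTop
      (𝓝 (Complex.exp (-(t ^ 2 * asympVar η₀f η₀c η₀W Mf Mc MW (fun k => G k) n φ ψ) / 2 : ℝ))) := by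
  have hsqrt : Tendsto (fun N : ℕ => √(N : ℝ)) atTop atTop :=
    Real.tendsto_sqrt_atTop.comp tendsto_natCast_atTop_atTop
  induction n generalizing φ ψ with
  | zero =>
    rw [asympVar_zero η₀f η₀c η₀W hη₀f hη₀c Mf Mc MW hMf hMc G hG hGf hGc]
    refine tendsto_iff_norm_sub_tendsto_zero.2 ?_
    refine squeeze_zero' (Eventually.of_forall fun N => norm_nonneg _) ?_
      (hsqrt.const_div_atTop ((|t| * (2 * ‖pairDiff φ ψ‖)) ^ 3 + (|t| * (2 * ‖pairDiff φ ψ‖)) ^ 4))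
    filter_upwards [eventually_gt_atTop 0, hsqrt.eventually_ge_atTop (|t| * (2 * ‖pairDiff φ ψ‖))]
      with N hN ht
    exact norm_charFun_avg_sub_exp_le η₀W (pairDiff φ ψ) hN ht
  | succ n ih =>
    set φ' := pullback η₀f Mf G hFelf n φ with hφ'
    set ψ' := pullback η₀c Mc G hFelc n ψ with hψ'
    have ih' := ih φ' ψ'
    rw [integral_pairDiff_limitCoupling η₀f η₀c η₀W hη₀f hη₀c Mf Mc MW hMf hMc G hG hGf hGc n,
      hφ', hψ', integral_pullback η₀f Mf G hG hGf, integral_pullback η₀c Mc G hG hGc, ← hφ',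
      ← hψ', sub_self] at ih'
    simp only [sub_zero] at ih'
    rw [asympVar_succ η₀f η₀c η₀W hη₀f hη₀c Mf Mc MW hMf hMc G hG hGf hGc hFelf hFelc, ← hφ',
      ← hψ']
    have hmean := integral_pairDiff_limitCoupling η₀f η₀c η₀W hη₀f hη₀c Mf Mc MW hMf hMc G hG
      hGf hGc (n + 1) φ ψ
    have hLp := (limitCoupling_marginals η₀f η₀c η₀W hη₀f hη₀c Mf Mc MW hMf hMc G hG
      hGf hGc (n + 1)).1
    have hT := tendsto_integral_abs_mutationLaw η₀f η₀c η₀W hη₀f hη₀c Mf Mc MW hMf hMc G hG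
      hGf hGc hQf hQc hFelf hFelc hFelW n
    obtain ⟨Cf, hCf, Hf⟩ := exists_linearisation_error_bound η₀f Mf G hG hGf hFelf η₀W MW
      (Or.inl rfl) hη₀f hMf n φ
    obtain ⟨Cc, hCc, Hc⟩ := exists_linearisation_error_bound η₀c Mc G hG hGc hFelc η₀W MW
      (Or.inr rfl) hη₀c hMc n ψ
    rw [← hφ'] at Hf
    rw [← hψ'] at Hc
    set L := limitCoupling η₀f η₀c η₀W Mf Mc MW (fun k => G k) (n + 1) with hL
    set F := pairDiff φ ψ with hF
    set V := ∫ u, (F u - ∫ v, F v ∂L) ^ 2 ∂L with hV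
    set σ := asympVar η₀f η₀c η₀W Mf Mc MW (fun k => G k) n φ' ψ' with hσ
    have hV0 : 0 ≤ V := integral_nonneg fun u => sq_nonneg _
    set c : ℂ := Complex.exp (-(t ^ 2 * V) / 2 : ℝ) with hc
    have hc1 : ‖c‖ ≤ 1 := by
      rw [hc, Complex.norm_exp, Complex.ofReal_re, Real.exp_le_one_iff]
      have : 0 ≤ t ^ 2 * V := by positivity
      linarith
    have hlim : Complex.exp (-(t ^ 2 * (σ + V)) / 2 : ℝ) =
        c * Complex.exp (-(t ^ 2 * σ) / 2 : ℝ) := by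
      rw [hc, ← Complex.exp_add]
      congr 1
      push_cast
      ring
    rw [hlim]
    -- It remains to compare the characteristic function at time n + 1 with c times the one at time
    -- n for (φ', ψ'), whose limit is the induction hypothesis.
    refine (tendsto_iff_of_dist ?_).1 (ih'.const_mul c)
    set B := (|t| * (2 * ‖F‖)) ^ 3 + (|t| * (2 * ‖F‖)) ^ 4 with hB
    have hbound : Tendsto (fun N : ℕ => B / √N + t ^ 2 / 2 *
        ((∫ u, |(∫ v, (F * F) v ∂(mutationLaw MW G N n u)) - ∫ v, (F * F) v ∂L|
            ∂(particleMarginal η₀W MW G N n)) +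
          2 * ‖F‖ * ∫ u, |(∫ v, F v ∂(mutationLaw MW G N n u)) - ∫ v, F v ∂L|
            ∂(particleMarginal η₀W MW G N n)) + |t| * ((Cf + Cc) / √N)) atTop (𝓝 0) := by
      have := ((hsqrt.const_div_atTop B).add
        (((hT (F * F)).add ((hT F).const_mul (2 * ‖F‖))).const_mul (t ^ 2 / 2))).add
        ((hsqrt.const_div_atTop (Cf + Cc)).const_mul |t|)
      simpa using this
    refine squeeze_zero' (Eventually.of_forall fun N => dist_nonneg) ?_ hbound
    filter_upwards [eventually_gt_atTop 0, hsqrt.eventually_ge_atTop (|t| * (2 * ‖F‖))] with N hN ht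
    obtain ⟨If, Bf⟩ := Hf N hN
    obtain ⟨Ic, Bc⟩ := Hc N hN
    set μ := particleMarginal η₀W MW G N n with hμ
    have hFm : Measurable F := F.continuous.measurable
    have hD : ∀ H : ℝ × ℝ →ᵇ ℝ, Integrable (fun u =>
        |(∫ v, H v ∂(mutationLaw MW G N n u)) - ∫ v, H v ∂L|) μ := fun H => by
      refine integrable_of_abs_le (((measurable_integral_kernel _
        H.continuous.measurable).sub_const _).abs) (K := ‖H‖ + ‖H‖) fun u => ?_
      rw [abs_abs]
      exact (abs_sub _ _).trans (add_le_add (abs_integral_le_of_abs_le (abs_apply_le_norm H))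
        (abs_integral_le_of_abs_le (abs_apply_le_norm H)))
    have hout : Integrable (fun v => Complex.exp ((t * √N * (avg v F - ∫ v, F v ∂L) : ℝ) *
        Complex.I)) (step MW G N n ∘ₘ μ) :=
      integrable_exp_mul_I (((measurable_avg hFm).sub_const _).const_mul _)
    have hin : Integrable (fun u => Complex.exp ((t * √N * avg u (pairDiff φ' ψ') : ℝ) *
        Complex.I)) μ :=
      integrable_exp_mul_I ((measurable_avg (pairDiff φ' ψ').continuous.measurable).const_mul _)
    rw [dist_comm, dist_eq_norm, particleMarginal, integral_comp_measure hout,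
      ← integral_const_mul, ← integral_sub (integrable_integral_comp_measure hout)
        (hin.const_mul c)]
    have hpt : ∀ u : Fin N → ℝ × ℝ,
        ‖(∫ v, Complex.exp ((t * √N * (avg v F - ∫ v, F v ∂L) : ℝ) * Complex.I)
          ∂(step MW G N n u)) -
          c * Complex.exp ((t * √N * avg u (pairDiff φ' ψ') : ℝ) * Complex.I)‖ ≤
        B / √N + t ^ 2 / 2 * (|(∫ v, (F * F) v ∂(mutationLaw MW G N n u)) - ∫ v, (F * F) v ∂L| +
          2 * ‖F‖ * |(∫ v, F v ∂(mutationLaw MW G N n u)) - ∫ v, F v ∂L|) +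
        |t| * (√N * (|(∫ v, φ v.1 ∂(mutationLaw MW G N n u)) -
            (∫ x, φ x ∂(predictor η₀f Mf (fun k => G k) (n + 1))) - avg u (fun v => φ' v.1)| +
          |(∫ v, ψ v.2 ∂(mutationLaw MW G N n u)) -
            (∫ x, ψ x ∂(predictor η₀c Mc (fun k => G k) (n + 1))) -
            avg u (fun v => ψ' v.2)|)) := by
      intro u
      set l := mutationLaw MW G N n u with hl
      set A := ∫ v, Complex.exp ((t * √N * (avg v F - ∫ v, F v ∂l) : ℝ) * Complex.I)
        ∂(Measure.pi fun _ : Fin N => l) with hA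
      set Vu := ∫ x, (F x - ∫ y, F y ∂l) ^ 2 ∂l with hVu
      have hVu0 : 0 ≤ Vu := integral_nonneg fun u => sq_nonneg _
      -- Given `u` the bias is a constant, so its phase factors out of the conditional
      -- characteristic function.
      have e1 : (∫ v, Complex.exp ((t * √N * (avg v F - ∫ v, F v ∂L) : ℝ) * Complex.I)
          ∂(step MW G N n u)) =
          A * Complex.exp ((t * √N * ((∫ v, F v ∂l) - ∫ v, F v ∂L) : ℝ) * Complex.I) := by
        rw [step_apply, hA, ← integral_mul_const]
        congr 1 with v
        rw [← Complex.exp_add]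
        congr 1
        push_cast
        ring
      have b1 : ‖A - c‖ ≤ B / √N + t ^ 2 / 2 * (|(∫ v, (F * F) v ∂l) - ∫ v, (F * F) v ∂L| +
          2 * ‖F‖ * |(∫ v, F v ∂l) - ∫ v, F v ∂L|) := by
        refine (norm_sub_le_norm_sub_add_norm_sub _
          (Complex.exp (-(t ^ 2 * Vu) / 2 : ℝ)) _).trans ?_
        refine add_le_add (norm_charFun_avg_sub_exp_le l F hN ht) ?_
        rw [hc, ← Complex.ofReal_exp, ← Complex.ofReal_exp, ← Complex.ofReal_sub,
          Complex.norm_real, Real.norm_eq_abs]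
        have p1 : 0 ≤ t ^ 2 * Vu := by positivity
        have p2 : 0 ≤ t ^ 2 * V := by positivity
        refine (abs_exp_sub_exp_le (by linarith) (by linarith)).trans ?_
        have e2 : -(t ^ 2 * Vu) / 2 - -(t ^ 2 * V) / 2 = -(t ^ 2 / 2) * (Vu - V) := by ring
        rw [e2, abs_mul, abs_neg, abs_of_nonneg (by positivity : 0 ≤ t ^ 2 / 2)]
        gcongr
        exact abs_integral_sq_sub_mean_sub_le l L F
      have b2 : ‖Complex.exp ((t * √N * ((∫ v, F v ∂l) - ∫ v, F v ∂L) : ℝ) * Complex.I) -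
          Complex.exp ((t * √N * avg u (pairDiff φ' ψ') : ℝ) * Complex.I)‖ ≤
          |t| * (√N * (|(∫ v, φ v.1 ∂l) -
            (∫ x, φ x ∂(predictor η₀f Mf (fun k => G k) (n + 1))) - avg u (fun v => φ' v.1)| +
          |(∫ v, ψ v.2 ∂l) -
            (∫ x, ψ x ∂(predictor η₀c Mc (fun k => G k) (n + 1))) -
            avg u (fun v => ψ' v.2)|)) := by
        refine (norm_exp_mul_I_sub_le _ _).trans ?_
        have e3 : avg u (pairDiff φ' ψ') = avg u (fun v => φ' v.1) - avg u (fun v => ψ' v.2) :=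
          avg_sub u _ _
        rw [hmean, hF, integral_pairDiff, e3, ← mul_sub, abs_mul, abs_mul,
          abs_of_nonneg (Real.sqrt_nonneg _), mul_assoc]
        gcongr
        refine le_trans (le_of_eq ?_) (abs_sub _ _)
        congr 1
        ring
      -- All phases and `c` have modulus at most 1, so the errors in the fluctuation and in the bias
      -- simply add.
      have e4 : A * Complex.exp ((t * √N * ((∫ v, F v ∂l) - ∫ v, F v ∂L) : ℝ) * Complex.I) -
          c * Complex.exp ((t * √N * avg u (pairDiff φ' ψ') : ℝ) * Complex.I) =
          (A - c) * Complex.exp ((t * √N * ((∫ v, F v ∂l) - ∫ v, F v ∂L) : ℝ) * Complex.I) +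
          c * (Complex.exp ((t * √N * ((∫ v, F v ∂l) - ∫ v, F v ∂L) : ℝ) * Complex.I) -
          Complex.exp ((t * √N * avg u (pairDiff φ' ψ') : ℝ) * Complex.I)) := by ring
      rw [e1, e4]
      refine (norm_add_le _ _).trans (add_le_add ?_ ?_)
      · rw [norm_mul, Complex.norm_exp_ofReal_mul_I, mul_one]
        exact b1
      · rw [norm_mul]
        exact (mul_le_of_le_one_left (norm_nonneg _) hc1).trans b2
    have j1 := (hD (F * F)).add ((hD F).const_mul (2 * ‖F‖))
    have j2 := (If.add Ic).const_mul (√N)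
    refine (norm_integral_le_integral_norm _).trans ?_
    refine (integral_mono_of_nonneg (ae_of_all _ fun u => norm_nonneg _)
      (((integrable_const (B / √N)).add (j1.const_mul (t ^ 2 / 2))).add (j2.const_mul |t|))
      (ae_of_all _ hpt)).trans ?_
    have hs : 0 < √(N : ℝ) := Real.sqrt_pos.2 (by exact_mod_cast hN)
    have hsN : √(N : ℝ) * √N = N := Real.mul_self_sqrt (by positivity)
    rw [integral_add' ((integrable_const (B / √N)).add (j1.const_mul (t ^ 2 / 2)))
      (j2.const_mul |t|), integral_add' (integrable_const (B / √N)) (j1.const_mul (t ^ 2 / 2)),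
      integral_const_mul, integral_const_mul, integral_const_mul,
      integral_add' (hD (F * F)) ((hD F).const_mul (2 * ‖F‖)), integral_add' If Ic,
      integral_const_mul]
    simp only [integral_const, probReal_univ, one_smul]
    gcongr
    calc √(N : ℝ) * _ ≤ √N * (Cf / N + Cc / N) := by gcongr
      _ = (Cf + Cc) / √N := by
        have hN' : (N : ℝ) ≠ 0 := by exact_mod_cast hN.ne'
        rw [← add_div, mul_div_assoc', div_eq_div_iff hN' hs.ne']
        linear_combination (Cf + Cc) * hsN

end Main

end MLPF

end

/-! ### From characteristic functions to convergence in distribution -/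

theorem theorem1
    -- initial laws and a coupling of them
    (η₀f η₀c : Measure ℝ) (η₀W : Measure (ℝ × ℝ))
    [IsProbabilityMeasure η₀f] [IsProbabilityMeasure η₀c] [IsProbabilityMeasure η₀W]
    (hη₀f : η₀W.map Prod.fst = η₀f) (hη₀c : η₀W.map Prod.snd = η₀c)
    -- Markov kernels (only the times `n ≥ 1` matter) and a coupling of them
    (Mf Mc : ℕ → Kernel ℝ ℝ) (MW : ℕ → Kernel (ℝ × ℝ) (ℝ × ℝ))
    [∀ n, IsMarkovKernel (Mf n)] [∀ n, IsMarkovKernel (Mc n)] [∀ n, IsMarkovKernel (MW n)]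
    (hMf : ∀ n, 1 ≤ n → ∀ u : ℝ × ℝ, (MW n u).map Prod.fst = Mf n u.1)
    (hMc : ∀ n, 1 ≤ n → ∀ u : ℝ × ℝ, (MW n u).map Prod.snd = Mc n u.2)
    -- nonnegative, bounded continuous potentials with positive normalising constants
    (G : ℕ → ℝ →ᵇ ℝ) (hG : ∀ n x, 0 ≤ G n x)
    (hGf : ∀ n, 0 < ∫ x, G n x ∂(MLPF.predictor η₀f Mf (fun k => G k) n))
    (hGc : ∀ n, 0 < ∫ x, G n x ∂(MLPF.predictor η₀c Mc (fun k => G k) n))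
    -- the filters have continuous distribution functions and generalised inverses
    (hFf : ∀ n, Continuous (MLPF.distFun (MLPF.filterM η₀f Mf (fun k => G k) n)))
    (hFc : ∀ n, Continuous (MLPF.distFun (MLPF.filterM η₀c Mc (fun k => G k) n)))
    (hQf : ∀ n, ContinuousOn (MLPF.quantile (MLPF.filterM η₀f Mf (fun k => G k) n))
      (Set.Ioo 0 1))
    (hQc : ∀ n, ContinuousOn (MLPF.quantile (MLPF.filterM η₀c Mc (fun k => G k) n))
      (Set.Ioo 0 1))
    -- the Feller property
    (hFelf : ∀ n, 1 ≤ n → MLPF.IsFeller (Mf n)) (hFelc : ∀ n, 1 ≤ n → MLPF.IsFeller (Mc n))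
    (hFelW : ∀ n, 1 ≤ n → MLPF.IsFeller (MW n))
    -- for every `N`, a multilevel particle filter with `N` pairs of particles
    {Ω : ℕ → Type*} [∀ N, MeasurableSpace (Ω N)] (P : (N : ℕ) → Measure (Ω N))
    [∀ N, IsProbabilityMeasure (P N)] (U : (N : ℕ) → ℕ → Ω N → Fin N → ℝ × ℝ)
    (hU : ∀ N, HasLaw (fun ω p => U N p ω) (MLPF.particleLaw η₀W MW G N) (P N))
    (n : ℕ) (φ ψ : ℝ →ᵇ ℝ) :
    TendstoInDistribution
      (fun (N : ℕ) (ω : Ω N) => √(N : ℝ) *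
        (∫ u, (φ u.1 - ψ u.2) ∂(MLPF.empirical (U N n ω)) -
          ∫ u, (φ u.1 - ψ u.2) ∂(MLPF.limitCoupling η₀f η₀c η₀W Mf Mc MW (fun k => G k) n)))
      atTop (id : ℝ → ℝ) P
      (gaussianReal 0
        (MLPF.asympVar η₀f η₀c η₀W Mf Mc MW (fun k => G k) n φ ψ).toNNReal) := by
  have hFm : Measurable (MLPF.pairDiff φ ψ) := (MLPF.pairDiff φ ψ).continuous.measurable
  set L := MLPF.limitCoupling η₀f η₀c η₀W Mf Mc MW (fun k => G k) n with hL
  have hY : ∀ N, Measurable fun u : Fin N → ℝ × ℝ =>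
      √(N : ℝ) * (MLPF.avg u (MLPF.pairDiff φ ψ) - ∫ v, MLPF.pairDiff φ ψ v ∂L) := fun N =>
    ((MLPF.measurable_avg hFm).sub_const _).const_mul _
  have hUm : ∀ N, AEMeasurable (U N n) (P N) := fun N =>
    (measurable_pi_apply n).comp_aemeasurable (hU N).aemeasurable
  have hlaw : ∀ N, (P N).map (U N n) = MLPF.particleMarginal η₀W MW G N n := fun N => by
    rw [← MLPF.map_eval_particleLaw, ← (hU N).map_eq,
      AEMeasurable.map_map_of_aemeasurable (measurable_pi_apply n).aemeasurable (hU N).aemeasurable]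
    rfl
  have hX : (fun (N : ℕ) (ω : Ω N) => √(N : ℝ) *
      (∫ u, (φ u.1 - ψ u.2) ∂(MLPF.empirical (U N n ω)) - ∫ u, (φ u.1 - ψ u.2) ∂L)) =
      fun (N : ℕ) (ω : Ω N) => √(N : ℝ) *
        (MLPF.avg (U N n ω) (MLPF.pairDiff φ ψ) - ∫ v, MLPF.pairDiff φ ψ v ∂L) := by
    ext N ω
    rw [← MLPF.integral_empirical _ hFm]
    rfl
  rw [hX]
  refine ⟨fun N => (hY N).comp_aemeasurable (hUm N), aemeasurable_id, ?_⟩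
  -- Lévy's continuity theorem; a zero variance needs no separate treatment, since the Gaussian
  -- characteristic function is then constantly 1.
  refine ProbabilityMeasure.tendsto_of_tendsto_charFun fun t => ?_
  have hlim := MLPF.tendsto_charFun_particleMarginal η₀f η₀c η₀W hη₀f hη₀c Mf Mc MW hMf hMc G hG
    hGf hGc hQf hQc hFelf hFelc hFelW n φ ψ t
  have hσ := MLPF.asympVar_nonneg η₀f η₀c η₀W Mf Mc MW (fun k => G k) n φ ψ
  simp only [ProbabilityMeasure.coe_mk, Measure.map_id, charFun_gaussianReal,
    Real.coe_toNNReal _ hσ]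
  convert hlim using 2 with N
  · have e : (P N).map (fun ω => √(N : ℝ) *
        (MLPF.avg (U N n ω) (MLPF.pairDiff φ ψ) - ∫ v, MLPF.pairDiff φ ψ v ∂L)) =
        (MLPF.particleMarginal η₀W MW G N n).map fun u =>
          √(N : ℝ) * (MLPF.avg u (MLPF.pairDiff φ ψ) - ∫ v, MLPF.pairDiff φ ψ v ∂L) := by
      rw [← hlaw, AEMeasurable.map_map_of_aemeasurable (hY N).aemeasurable (hUm N)]
      rfl
    rw [e, charFun_apply_real, integral_map (hY N).aemeasurable (by fun_prop)]
    congr 1 with u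
    congr 1
    push_cast
    ring
  · congr 1
    push_cast
    ring
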